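/- Colored Arc Kayles is played on a finite simple graph $G=(V,E)$ whose edges are coloured gray, black or white. Two players, Black and White, alternately select an edge; Black may select gray and black edges, White may select gray and white edges. Both endpoints of the selected edge are removed from the graph together with all incident edges, and a player who cannot move loses. BW-Arc Kayles is the game on graphs without gray edges, and Arc Kayles is the game on graphs all of whose edges are gray. A position is an induced subgraph $G[A]$, $A\subseteq V$, together with the player to move. Running time is the number of elementary steps of a program in a unit-cost model (first-order functional programs over binary trees, i.e. pure LISP, which a random access machine executes with constant overhead per step). The input is the coloured adjacency matrix of a graph on $n$ vertices and the player who moves first; the output tells whether that player wins. $O^*(\cdot)$ suppresses a factor polynomial in $n$. Let $\tau$ be the vertex cover number of $G$. **Theorem.** 1. The winner of Colored Arc Kayles can be determined in time $O^*(1.4143^{\tau^2+3.17\tau})$, the winner of BW-Arc Kayles in time $O^*(1.3161^{\tau^2+4\tau})$, and the winner of Arc Kayles in time $O^*(1.1893^{\tau^2+6.34\tau})$. 2. Let $S$ be a vertex cover of $G$ and $A\subseteq V$. Call $v,v'\in A\setminus S$ equivalent if they have the same neighbours in $G[A]$, joined to them by edges of the same colours, and let $R$ contain exactly one vertex of each equivalence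 class of $A\setminus S$. Then a player who is to move in $G[A]$ wins if and only if he may select an edge $\{u,v\}$ of $G[A]$ with $u\in S$ and $v\in S\cup R$ such that his opponent, who is then to move in $G[A\setminus\{u,v\}]$, does not win. 3. Let $S$ be a non-empty vertex cover of $G$ and let $\gamma$ be the number of colours that occur on edges of $G$. Identify two subgraphs $G[A]$ and $G[B]$ if $A\cap S=B\cap S$ and there is a colour-preserving isomorphism $G[A]\to G[B]$ that fixes every vertex of $A\cap S$. Then at most $$(\gamma+1)^{|S|^2/4}\cdot 3^{|S|}\cdot |S|^2$$ distinct subgraphs $G[A]$ occur as positions in plays of Colored Arc Kayles on $G$ (with either player moving first). -/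

import Mathlib

namespace ArcKayles

/-! ### Edge-coloured graphs and the game -/

/-- The three colours of edges. -/
inductive EdgeColor
  | gray
  | black
  | white
  deriving DecidableEq

/-- A finite simple graph whose edges are coloured gray, black or white: `color u v = none` means
that `u` and `v` are not adjacent, `color u v = some c` that `{u, v}` is an edge of colour `c`. -/
structure ColoredGraph (V : Type*) where
  color : V → V → Option EdgeColor
  symm : ∀ u v, color u v = color v u
  loopless : ∀ v, color v v = none

/-- The two players, Black and White. -/
inductive Player
  | black
  | white
  deriving DecidableEq

/-- The opponent of a player. -/
def Player.other : Player → Player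
  | .black => .white
  | .white => .black

/-- Black may select gray and black edges, White may select gray and white edges. -/
def Player.MaySelect : Player → EdgeColor → Prop
  | .black, c => c = .gray ∨ c = .black
  | .white, c => c = .gray ∨ c = .white

namespace ColoredGraph

variable {V : Type*} (G : ColoredGraph V)

/-- The underlying uncoloured graph. -/
def graph : SimpleGraph V where
  Adj u v := G.color u v ≠ none
  symm := ⟨fun u v h => by rw [G.symm v u]; exact h⟩
  loopless := ⟨fun v h => h (G.loopless v)⟩

/-- The number `γ` of colours that occur on edges of `G`. -/
noncomputable def numColors : ℕ :=
  {c : EdgeColor | ∃ u v, G.color u v = some c}.ncard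

/-- The instances of BW-Arc Kayles: every edge is black or white. -/
def IsBW : Prop := ∀ u v, G.color u v ≠ some .gray

/-- The instances of Arc Kayles: every edge may be selected by both players, that is, it is gray. -/
def IsArcKayles : Prop := ∀ u v c, G.color u v = some c → c = .gray

/-- A position is given by the set `A` of the remaining vertices; the remaining graph is `G[A]`.
`IsMove p A u v`: in this position the player `p` may select the edge `{u, v}`. -/
def IsMove (p : Player) (A : Finset V) (u v : V) : Prop :=
  u ∈ A ∧ v ∈ A ∧ ∃ c, G.color u v = some c ∧ p.MaySelect c

variable [DecidableEq V]

/-- `Wins p A`: in the position `G[A]` with the player `p` to move, `p` wins. A move removes both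
endpoints of the selected edge; a player who cannot move loses. -/
def Wins (p : Player) (A : Finset V) : Prop :=
  ∃ u v, ∃ _ : G.IsMove p A u v, ¬ Wins p.other (A \ {u, v})
termination_by A.card
decreasing_by
  rename_i h
  exact Finset.card_lt_card (Finset.ssubset_iff_of_subset Finset.sdiff_subset |>.2
    ⟨u, h.1, by simp⟩)

/-- The positions, with the player to move, that occur in plays on `G` (either player may start,
the players alternate). -/
inductive Reachable [Fintype V] : Player → Finset V → Prop
  | start (p : Player) : Reachable p Finset.univ
  | move {p : Player} {A : Finset V} {u v : V} :
      Reachable p A → G.IsMove p A u v → Reachable p.other (A \ {u, v})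

/-- Two vertices of `G[A]` have the same neighbourhood in `G[A]`, with the same edge colours. -/
def SameNeighbors (A : Finset V) (v w : V) : Prop :=
  ∀ u ∈ A, G.color u v = G.color u w

/-- `R` consists of one representative from each class of vertices of `A \ S` with the same
coloured neighbourhood in `G[A]`. -/
def IsRepresentativeSystem (S A R : Finset V) : Prop :=
  R ⊆ A \ S ∧ ∀ v ∈ A \ S, ∃! r, r ∈ R ∧ G.SameNeighbors A v r

/-- `G[A]` and `G[B]` contain the same vertices of `S`, and there is an isomorphism of
edge-coloured graphs from `G[A]` to `G[B]` that fixes each of these vertices. -/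
def SamePosition (S A B : Finset V) : Prop :=
  A ∩ S = B ∩ S ∧ ∃ f : Equiv.Perm V, (∀ v, v ∈ A ↔ f v ∈ B) ∧ (∀ v ∈ A ∩ S, f v = v) ∧
    ∀ u ∈ A, ∀ v ∈ A, G.color (f u) (f v) = G.color u v

/-- The positions that occur in plays on `G`, identified along `SamePosition S`. -/
def positionSetoid [Fintype V] (S : Finset V) :
    Setoid {A : Finset V // ∃ p, G.Reachable p A} where
  r A B := G.SamePosition S A B
  iseqv :=
    { refl := fun A => ⟨rfl, 1, by simp⟩
      symm := by
        rintro ⟨A, _⟩ ⟨B, _⟩ ⟨h, f, hf, hS, hc⟩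
        refine ⟨h.symm, f.symm, fun v => ?_, fun v hv => ?_, fun u hu v hv => ?_⟩
        · simpa using (hf (f.symm v)).symm
        · rw [Equiv.symm_apply_eq]
          exact (hS v (h.symm ▸ hv)).symm
        · have hu' : f.symm u ∈ A := (hf _).2 (by simpa using hu)
          have hv' : f.symm v ∈ A := (hf _).2 (by simpa using hv)
          simpa using (hc _ hu' _ hv').symm
      trans := by
        rintro ⟨A, _⟩ ⟨B, _⟩ ⟨C, _⟩ ⟨h, f, hf, hS, hc⟩ ⟨k, g, hg, kS, kc⟩
        refine ⟨h.trans k, f.trans g, fun v => (hf v).trans (hg _), fun v hv => ?_,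
          fun u hu v hv => ?_⟩
        · rw [Equiv.trans_apply, hS v hv, kS v (h ▸ hv)]
        · exact (kc _ ((hf u).1 hu) _ ((hf v).1 hv)).trans (hc u hu v hv) }

/-- The number of distinct positions that occur in plays on `G`. -/
noncomputable def numPositions [Fintype V] (S : Finset V) : ℕ :=
  Nat.card (Quotient (G.positionSetoid S))

end ColoredGraph

/-! ### The machine model

First-order functional programs over binary trees (pure LISP): the data are built from `nil` by
pairing, and a program is a list of function bodies, each with one argument, which may call each
other. Every elementary operation costs one unit of time. A random access machine executes such a
program with constant overhead per step, trees being pointers (of length logarithmic in the time) to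
immutable cells. -/

/-- The data of the machine. -/
inductive Data
  | nil
  | cons (a b : Data)

/-- The bodies of functions. -/
inductive Code
  | arg
  | nil
  | cons (a b : Code)
  | head (a : Code)
  | tail (a : Code)
  | ite (c a b : Code)
  | call (f : ℕ) (a : Code)

/-- A program: the function `f` has the body `P[f]`. -/
abbrev Program := List Code

/-- `Eval P x e y t`: in the program `P`, the expression `e` with the argument `x` of the current
function evaluates to `y` in exactly `t` steps. -/
inductive Eval (P : Program) : Data → Code → Data → ℕ → Prop
  | arg {x} : Eval P x .arg x 1
  | nil {x} : Eval P x .nil .nil 1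
  | cons {x a b v w s t} : Eval P x a v s → Eval P x b w t →
      Eval P x (.cons a b) (.cons v w) (s + t + 1)
  | head_nil {x a s} : Eval P x a .nil s → Eval P x (.head a) .nil (s + 1)
  | head_cons {x a v w s} : Eval P x a (.cons v w) s → Eval P x (.head a) v (s + 1)
  | tail_nil {x a s} : Eval P x a .nil s → Eval P x (.tail a) .nil (s + 1)
  | tail_cons {x a v w s} : Eval P x a (.cons v w) s → Eval P x (.tail a) w (s + 1)
  | ite_nil {x c a b y s t} : Eval P x c .nil s → Eval P x b y t →
      Eval P x (.ite c a b) y (s + t + 1)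
  | ite_cons {x c a b v w y s t} : Eval P x c (.cons v w) s → Eval P x a y t →
      Eval P x (.ite c a b) y (s + t + 1)
  | call {x f a body v y s t} : P[f]? = some body → Eval P x a v s → Eval P v body y t →
      Eval P x (.call f a) y (s + t + 1)

/-- The machine is deterministic: output and running time are unique. -/
theorem Eval.unique {P : Program} {x : Data} {e : Code} {y z : Data} {s t : ℕ}
    (h : Eval P x e y s) (k : Eval P x e z t) : y = z ∧ s = t := by
  induction h generalizing z t with
  | call hb _ _ ih ih' =>
    cases k with
    | call kb k k' =>
      obtain rfl := Option.some.inj (hb.symm.trans kb)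
      obtain ⟨rfl, rfl⟩ := ih k
      obtain ⟨rfl, rfl⟩ := ih' k'
      exact ⟨rfl, rfl⟩
  | _ => cases k <;> grind

/-- On the input `x`, the program `P` (its function `0`) halts with the output `y` after exactly `t`
steps. -/
def Program.Runs (P : Program) (x y : Data) (t : ℕ) : Prop :=
  Eval P x (.call 0 .arg) y t

/-! ### Encoding of instances -/

/-- Truth values as data. -/
def encodeBool : Bool → Data
  | false => .nil
  | true => .cons .nil .nil

/-- Lists as data. -/
def encodeList : List Data → Data
  | [] => .nil
  | a :: l => .cons a (encodeList l)

/-- Players as data. -/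
def encodePlayer : Player → Data
  | .black => encodeBool true
  | .white => encodeBool false

/-- Entries of the coloured adjacency matrix as data: adjacency is followed by two bits that tell
whether Black and White, respectively, may select the edge. -/
def encodeEntry : Option EdgeColor → Data
  | none => .nil
  | some .gray => .cons (encodeBool true) (encodeBool true)
  | some .black => .cons (encodeBool true) (encodeBool false)
  | some .white => .cons (encodeBool false) (encodeBool true)

/-- An instance of the game: the player who moves first and the coloured adjacency matrix, as the
list of its rows. -/
def encodeInstance {n : ℕ} (G : ColoredGraph (Fin n)) (p : Player) : Data :=
  .cons (encodePlayer p)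
    (encodeList (List.ofFn fun i => encodeList (List.ofFn fun j => encodeEntry (G.color i j))))

/-- For the instances of Colored Arc Kayles in the class `C`, the winner can be determined in time
`O*(T τ)`, where `τ` is the vertex cover number: there is one program that, on every graph `G` in
`C` with vertices `0, …, n - 1` and every first player `p`, decides whether `p` wins, within
`q(n) * T τ` steps for a fixed polynomial `q`. -/
def WinnerDeterminedInTime (C : ∀ n : ℕ, ColoredGraph (Fin n) → Prop) (T : ℕ → ℝ) : Prop :=
  ∃ (P : Program) (q : Polynomial ℕ),
    ∀ (n : ℕ) (G : ColoredGraph (Fin n)) (p : Player) (τ : ℕ),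
      C n G → G.graph.vertexCoverNum = τ →
        ∃ (b : Bool) (t : ℕ), (b = true ↔ G.Wins p Finset.univ) ∧
          P.Runs (encodeInstance G p) (encodeBool b) t ∧ (t : ℝ) ≤ (q.eval n : ℕ) * T τ

end ArcKayles

/-! Fix a vertex cover S. Vertices outside S have neighbours only in S, so those with the same
coloured neighbourhood in X = A ∩ S are interchangeable in `G[A]`. Hence `G[A]` is determined, up to
an isomorphism fixing X, by X and by the number of removed vertices of each neighbourhood type
outside S. `positionKey` records X and the list of types of the removed vertices; equal keys give
isomorphic positions (`samePosition_of_positionKey_eq`). The list is ordered, so isomorphic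
positions may have different keys, which only weakens the upper bound.

Every move deletes at least one vertex of S and at most one outside it. Thus in a play the number k
of vertices removed outside S is at most the number removed from S (`IsBalanced`). With s = |S| and
x = |X| this reads x + k ≤ s. A type assigns to each vertex of X a colour or non-adjacency, so for
given X and k there are at most (γ+1)^(xk) ≤ (γ+1)^(s²/4) lists. There are s - x + 1 ≤ 2^(s-x)
values of k, and the sum over X ⊆ S of 2^(s-x) is 3^s. This is `card_keys_le`, which bounds both the
number of positions and the size of the memo.

The recursion over representatives holds because exchanging two equivalent vertices is an
isomorphism between the positions reached by removing one or the other. The program does not need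
it: its search tries all pairs of vertices and saves work by memoization alone.

The program finds a cover of size at most τ by branching on uncovered edges, in time 2^τ up to a
polynomial factor, and then searches the game with a memo, a binary trie indexed by the keys written
as bit strings. The time is amortized: a memo hit costs polynomial time, and a miss creates exactly
one new entry, which pays for the loop over all pairs (`computes_loop`, `solves`). The total is
polynomial times (γ+1)^(τ²/4) 3^τ, and the stated bases b and exponents e satisfy γ+1 ≤ b^4 and 3 ≤
b^e. -/

namespace ArcKayles

namespace ColoredGraph

/-! ### The colours that occur -/

variable {V : Type*} (G : ColoredGraph V)

open Classical in
/-- The values of `color`. -/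
noncomputable def colorValues [Fintype V] : Finset (Option EdgeColor) :=
  insert none ((Finset.univ ×ˢ Finset.univ).image fun x : V × V => G.color x.1 x.2)

/-- The additional value is `none`, for non-adjacent pairs; this is the source of the base γ + 1. -/
theorem card_colorValues_le [Fintype V] : G.colorValues.card ≤ G.numColors + 1 := by
  classical
  have h : (G.colorValues : Set (Option EdgeColor)) ⊆
      insert none (some '' {c : EdgeColor | ∃ u v, G.color u v = some c}) := by
    intro x hx
    rcases x with _ | c
    · simp
    · simpa [colorValues] using hx
  have hfin : {c : EdgeColor | ∃ u v, G.color u v = some c}.Finite := by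
    have : Finite EdgeColor := Finite.of_surjective
      (fun i : Fin 3 => if i = 0 then EdgeColor.gray else if i = 1 then .black else .white) (by
        intro c
        cases c
        exacts [⟨0, by simp⟩, ⟨1, by simp⟩, ⟨2, by simp⟩])
    exact Set.toFinite _
  rw [← Set.ncard_coe_finset]
  refine (Set.ncard_le_ncard h ((hfin.image _).insert _)).trans ((Set.ncard_insert_le _ _).trans ?_)
  exact Nat.add_le_add_right (Set.ncard_image_le hfin) 1

/-! ### Moves, isomorphic positions and representatives -/

variable {G}

theorem IsMove.swap {p : Player} {A : Finset V} {u v : V} (h : G.IsMove p A u v) :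
    G.IsMove p A v u := by
  obtain ⟨hu, hv, c, hc, hp⟩ := h
  exact ⟨hv, hu, c, by rw [G.symm, hc], hp⟩

theorem IsMove.adj {p : Player} {A : Finset V} {u v : V} (h : G.IsMove p A u v) :
    G.graph.Adj u v := by
  obtain ⟨-, -, c, hc, -⟩ := h
  simp [graph, hc]

theorem IsMove.ne {p : Player} {A : Finset V} {u v : V} (h : G.IsMove p A u v) : u ≠ v :=
  h.adj.ne

variable (G) [DecidableEq V]

theorem wins_iff {p : Player} {A : Finset V} :
    G.Wins p A ↔ ∃ u v, G.IsMove p A u v ∧ ¬ G.Wins p.other (A \ {u, v}) := by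
  rw [Wins]
  simp only [exists_prop]

variable {G}

theorem IsMove.sdiff_ssubset {p : Player} {A : Finset V} {u v : V} (h : G.IsMove p A u v) :
    A \ {u, v} ⊂ A :=
  (Finset.ssubset_iff_of_subset Finset.sdiff_subset).2 ⟨u, h.1, by simp⟩

/-- Isomorphic positions have the same winner. -/
theorem wins_congr {p : Player} {A B : Finset V} (f : Equiv.Perm V) (hf : ∀ v, v ∈ A ↔ f v ∈ B)
    (hc : ∀ u ∈ A, ∀ v ∈ A, G.color (f u) (f v) = G.color u v) : G.Wins p A ↔ G.Wins p B := by
  induction A using Finset.strongInduction generalizing p B with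
  | H A ih =>
    rw [wins_iff, wins_iff]
    refine f.exists_congr fun u => f.exists_congr fun v => ?_
    have hm : G.IsMove p A u v ↔ G.IsMove p B (f u) (f v) := by
      unfold IsMove
      rw [← hf, ← hf]
      refine and_congr_right fun hu => and_congr_right fun hv => ?_
      rw [hc u hu v hv]
    rw [← hm]
    refine and_congr_right fun h => not_congr (ih _ h.sdiff_ssubset (fun w => ?_) ?_)
    · simp [hf w]
    · intro a ha b hb
      exact hc a (Finset.sdiff_subset ha) b (Finset.sdiff_subset hb)

theorem SamePosition.wins_iff {S A B : Finset V} (h : G.SamePosition S A B) (p : Player) :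
    G.Wins p A ↔ G.Wins p B := by
  obtain ⟨-, f, hf, -, hc⟩ := h
  exact wins_congr f hf hc

/-- Consequently a proper subposition never shares its key with the position itself, which the
amortization of the search relies on. -/
theorem SamePosition.card_eq {S A B : Finset V} (h : G.SamePosition S A B) : A.card = B.card := by
  obtain ⟨-, f, hf, -, -⟩ := h
  have : A.map f.toEmbedding = B := by
    ext v
    rw [Finset.mem_map_equiv, hf]
    simp
  rw [← this, Finset.card_map]

/-- Moving to a vertex or to another one with the same neighbours leads to isomorphic positions. -/
theorem SameNeighbors.wins_sdiff {A : Finset V} {u v r : V} (h : G.SameNeighbors A v r)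
    (hu : u ≠ v) (hu' : u ≠ r) (hv : v ∈ A) (hr : r ∈ A) (p : Player) :
    G.Wins p (A \ {u, v}) ↔ G.Wins p (A \ {u, r}) := by
  -- Once v is gone, the transposition of v and r moves only r among the remaining vertices. This
  -- covers all pairs whose second vertex is not r.
  have h1 : ∀ a ∈ A \ {u, v}, ∀ b ∈ A \ {u, v}, b ≠ r →
      G.color (Equiv.swap v r a) b = G.color a b := by
    intro a ha b hb hbr
    simp only [Finset.mem_sdiff, Finset.mem_insert, Finset.mem_singleton, not_or] at ha hb
    by_cases har : a = r
    · subst har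
      rw [Equiv.swap_apply_right, G.symm, h b hb.1, G.symm]
    · rw [Equiv.swap_apply_of_ne_of_ne ha.2.2 har]
  refine wins_congr (Equiv.swap v r) (fun w => ?_) fun a ha b hb => ?_
  · rcases eq_or_ne w v with rfl | hwv
    · simp
    rcases eq_or_ne w r with rfl | hwr
    · simp [hv, hr, hu.symm, hu'.symm, hwv, hwv.symm]
    · simp [Equiv.swap_apply_of_ne_of_ne hwv hwr, hwv, hwr]
  · by_cases hbr : b = r
    · by_cases har : a = r
      · rw [hbr, har, G.loopless, G.loopless]
      · have hav : a ≠ v := by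
          rintro rfl
          simp at ha
        rw [Equiv.swap_apply_of_ne_of_ne hav har, hbr, Equiv.swap_apply_right]
        exact h a (Finset.sdiff_subset ha)
    · have hbv : b ≠ v := by
        rintro rfl
        simp at hb
      rw [Equiv.swap_apply_of_ne_of_ne hbv hbr]
      exact h1 a ha b hb hbr

/-- Every edge has an endpoint in S; if the other one lies outside S, it can be replaced by its
representative without changing the value of the move. -/
theorem wins_iff_representatives {S A R : Finset V} (hS : G.graph.IsVertexCover (S : Set V))
    (hR : G.IsRepresentativeSystem S A R) (p : Player) :
    G.Wins p A ↔ ∃ u v, u ∈ S ∧ (v ∈ S ∨ v ∈ R) ∧ G.IsMove p A u v ∧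
      ¬ G.Wins p.other (A \ {u, v}) := by
  rw [wins_iff]
  constructor
  · rintro ⟨u, v, hm, hw⟩
    wlog hu : u ∈ S generalizing u v
    · refine this v u hm.swap (by rwa [Finset.pair_comm]) ?_
      exact (hS hm.adj).resolve_left hu
    by_cases hv : v ∈ S
    · exact ⟨u, v, hu, .inl hv, hm, hw⟩
    obtain ⟨r, ⟨hr, hvr⟩, -⟩ := hR.2 v (Finset.mem_sdiff.2 ⟨hm.2.1, hv⟩)
    have hrA := Finset.mem_sdiff.1 (hR.1 hr)
    refine ⟨u, r, hu, .inr hr, ?_, ?_⟩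
    · obtain ⟨huA, -, c, hc, hp⟩ := hm
      exact ⟨huA, hrA.1, c, by rw [← hvr u huA, hc], hp⟩
    · rwa [← hvr.wins_sdiff hm.ne (fun h => hrA.2 (h ▸ hu)) hm.2.1 hrA.1]
  · rintro ⟨u, v, -, -, hm, hw⟩
    exact ⟨u, v, hm, hw⟩

/-! ### Keys of positions -/

variable (G)

/-- The edges that join `v` to vertices of `X`. -/
def colorsTo (X : Finset V) (v : V) : V → Option EdgeColor :=
  fun u => if u ∈ X then G.color u v else none

/-- The remaining vertices of `S`, and the list of the neighbourhoods, in these, of the removed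
vertices outside `S`. The vertices are enumerated by `l`. -/
def positionKey (l : List V) (S A : Finset V) : Finset V × List (V → Option EdgeColor) :=
  (A ∩ S, (l.filter fun v => v ∉ S ∧ v ∉ A).map (G.colorsTo (A ∩ S)))

variable {G} [Fintype V]

theorem card_removed_eq_count {l : List V} (hl : l.Nodup) (hm : ∀ v, v ∈ l) (S A : Finset V)
    (t : V → Option EdgeColor) :
    (Finset.univ.filter fun v => v ∉ S ∧ G.colorsTo (A ∩ S) v = t ∧ v ∉ A).card =
      (G.positionKey l S A).2.countP (fun x => x = t) := by
  rw [positionKey, List.countP_map, List.countP_filter, List.countP_eq_length_filter,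
    ← List.toFinset_card_of_nodup (hl.filter _)]
  congr 1
  ext v
  simp [hm, and_left_comm]

/-- Equal keys mean equally many removed vertices of each type. The total number of vertices of a
type outside S depends only on X, so equally many remain as well, and a bijection can be chosen type
by type. -/
theorem samePosition_of_positionKey_eq {l : List V} (hl : l.Nodup) (hm : ∀ v, v ∈ l)
    {S A B : Finset V} (hS : G.graph.IsVertexCover (S : Set V))
    (h : G.positionKey l S A = G.positionKey l S B) : G.SamePosition S A B := by
  have hX : A ∩ S = B ∩ S := congrArg Prod.fst h
  -- A label for each vertex: itself inside S, and otherwise its type and whether it is still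
  -- present. A permutation carrying the labels for A to those for B is the required isomorphism.
  let g (C : Finset V) (v : V) : V ⊕ (V → Option EdgeColor) × Prop :=
    if v ∈ S then .inl v else .inr (G.colorsTo (A ∩ S) v, v ∈ C)
  have hrem : ∀ t, (Finset.univ.filter fun v => v ∉ S ∧ G.colorsTo (A ∩ S) v = t ∧ v ∉ A).card =
      (Finset.univ.filter fun v => v ∉ S ∧ G.colorsTo (A ∩ S) v = t ∧ v ∉ B).card := by
    intro t
    rw [card_removed_eq_count hl hm, h, ← card_removed_eq_count hl hm, hX]
  have hsplit : ∀ (C : Finset V) t,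
      (Finset.univ.filter fun v => v ∉ S ∧ G.colorsTo (A ∩ S) v = t).card =
      (Finset.univ.filter fun v => v ∉ S ∧ G.colorsTo (A ∩ S) v = t ∧ v ∈ C).card +
      (Finset.univ.filter fun v => v ∉ S ∧ G.colorsTo (A ∩ S) v = t ∧ v ∉ C).card := by
    intro C t
    rw [← Finset.card_filter_add_card_filter_not (fun v => v ∈ C), Finset.filter_filter,
      Finset.filter_filter]
    simp only [and_assoc]
  have hcard : ∀ c, Nonempty ({v // g A v = c} ≃ {v // g B v = c}) := by
    intro c
    have : Nat.card {v // g A v = c} = Nat.card {v // g B v = c} := by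
      classical
      rw [Nat.card_eq_fintype_card, Nat.card_eq_fintype_card, Fintype.card_subtype,
        Fintype.card_subtype]
      rcases c with w | ⟨t, q⟩
      · congr 1
        ext v
        by_cases hv : v ∈ S <;> simp [g, hv]
      · have hg : ∀ C : Finset V, (Finset.univ.filter fun v => g C v = .inr (t, q)) =
            Finset.univ.filter fun v => v ∉ S ∧ G.colorsTo (A ∩ S) v = t ∧ (v ∈ C ↔ q) := by
          intro C
          ext v
          by_cases hv : v ∈ S <;> simp [g, hv]
        rw [hg, hg]
        by_cases hq : q
        · simp only [hq, iff_true]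
          have h1 := hsplit A t
          have h2 := hsplit B t
          have h3 := hrem t
          omega
        · simpa only [hq, iff_false] using hrem t
    exact Finite.card_eq.1 this
  let e := fun c => (hcard c).some
  let f : Equiv.Perm V := Equiv.ofFiberEquiv e
  have hf : ∀ v, g B (f v) = g A v := Equiv.ofFiberEquiv_map e
  have hfS : ∀ v ∈ S, f v = v := by
    intro v hv
    have := hf v
    by_cases hv' : f v ∈ S
    · simpa [g, hv, hv'] using this
    · simp [g, hv, hv'] at this
  have hfn : ∀ v, v ∉ S → f v ∉ S ∧ G.colorsTo (A ∩ S) (f v) = G.colorsTo (A ∩ S) v ∧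
      (f v ∈ B ↔ v ∈ A) := by
    intro v hv
    have := hf v
    by_cases hv' : f v ∈ S
    · simp [g, hv, hv'] at this
    · simpa [g, hv, hv'] using this
  have hXf : ∀ u ∈ A, u ∈ S → ∀ v, v ∉ S → G.color u (f v) = G.color u v := by
    intro u hu huS v hv
    simpa [colorsTo, hu, huS] using congrFun (hfn v hv).2.1 u
  refine ⟨hX, f, fun v => ?_, fun v hv => hfS v (Finset.mem_inter.1 hv).2, fun u hu v hv => ?_⟩
  · by_cases hv : v ∈ S
    · rw [hfS v hv]
      simpa [hv] using Finset.ext_iff.1 hX v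
    · exact (hfn v hv).2.2.symm
  · by_cases huS : u ∈ S <;> by_cases hvS : v ∈ S
    · rw [hfS u huS, hfS v hvS]
    · rw [hfS u huS, hXf u hu huS v hvS]
    · rw [hfS v hvS, G.symm, hXf v hv hvS u huS, G.symm]
    -- No edge avoids the cover S, so two vertices outside S impose no condition.
    · have hnone : ∀ a b, a ∉ S → b ∉ S → G.color a b = none := by
        intro a b ha hb
        by_contra hab
        exact (hS hab).elim ha hb
      rw [hnone _ _ huS hvS, hnone _ _ (hfn u huS).1 (hfn v hvS).1]

/-! ### The balance between removed vertices inside and outside the cover -/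

/-- Every vertex removed outside `S` is matched with a vertex removed in `S`. -/
def IsBalanced (S A : Finset V) : Prop :=
  ((Finset.univ \ S) \ A).card ≤ (S \ A).card

theorem isBalanced_univ (S : Finset V) : IsBalanced S Finset.univ := by
  simp [IsBalanced]

/-- The selected edge has an endpoint in S, so the right-hand count grows by at least one and the
left-hand count by at most one. -/
theorem IsBalanced.move {S A : Finset V} (hS : G.graph.IsVertexCover (S : Set V))
    (h : IsBalanced S A) {p : Player} {u v : V} (hm : G.IsMove p A u v) :
    IsBalanced S (A \ {u, v}) := by
  wlog hu : u ∈ S generalizing u v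
  · rw [Finset.pair_comm]
    exact this hm.swap ((hS hm.adj).resolve_left hu)
  unfold IsBalanced at *
  have h1 : (S \ A).card + 1 ≤ (S \ (A \ {u, v})).card := by
    rw [← Finset.card_insert_of_notMem (a := u) (s := S \ A) (by simp [hm.1])]
    refine Finset.card_le_card fun w hw => ?_
    grind
  have h2 : ((Finset.univ \ S) \ (A \ {u, v})).card ≤ ((Finset.univ \ S) \ A).card + 1 := by
    refine (Finset.card_le_card (t := insert v ((Finset.univ \ S) \ A)) fun w hw => ?_).trans
      (Finset.card_insert_le _ _)
    grind
  omega

theorem Reachable.isBalanced {S : Finset V} (hS : G.graph.IsVertexCover (S : Set V)) {p : Player}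
    {A : Finset V} (h : G.Reachable p A) : IsBalanced S A := by
  induction h with
  | start p => exact isBalanced_univ S
  | move _ hm ih => exact ih.move hS hm

/-! ### Counting keys and positions -/

variable (G)

open Classical in
/-- The possible values of `colorsTo X`. -/
noncomputable def neighborhoods (X : Finset V) : Finset (V → Option EdgeColor) :=
  Fintype.piFinset fun v => if v ∈ X then G.colorValues else {none}

theorem card_neighborhoods (X : Finset V) :
    (G.neighborhoods X).card = G.colorValues.card ^ X.card := by
  classical
  rw [neighborhoods, Fintype.card_piFinset]
  have : ∀ v, (if v ∈ X then G.colorValues else {none}).card =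
      if v ∈ X then G.colorValues.card else 1 := by
    intro v
    split_ifs <;> simp
  simp only [this]
  rw [Finset.prod_ite]
  simp

theorem colorsTo_mem_neighborhoods (X : Finset V) (v : V) : G.colorsTo X v ∈ G.neighborhoods X := by
  classical
  rw [neighborhoods, Fintype.mem_piFinset]
  intro u
  by_cases hu : u ∈ X
  · simp [colorsTo, hu, colorValues]
  · simp [colorsTo, hu]

open Classical in
/-- The keys of the balanced positions. -/
noncomputable def keys (l : List V) (S : Finset V) :
    Finset (Finset V × List (V → Option EdgeColor)) :=
  (Finset.univ.filter fun A => IsBalanced S A).image (G.positionKey l S)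

theorem mem_keys (l : List V) {S A : Finset V} (h : IsBalanced S A) :
    G.positionKey l S A ∈ G.keys l S := by
  classical
  exact Finset.mem_image_of_mem _ (by simpa using h)

theorem card_keys_le {l : List V} (hl : l.Nodup) (S : Finset V) :
    (G.keys l S).card ≤ (G.numColors + 1) ^ (S.card ^ 2 / 4) * 3 ^ S.card := by
  classical
  set c := G.numColors + 1
  let lists (X : Finset V) (k : ℕ) : Finset (Finset V × List (V → Option EdgeColor)) :=
    (Fintype.piFinset fun _ : Fin k => G.neighborhoods X).image fun x => (X, List.ofFn x)
  have hlists : ∀ X k, (lists X k).card ≤ c ^ (X.card * k) := by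
    intro X k
    refine Finset.card_image_le.trans ?_
    rw [Fintype.card_piFinset, Finset.prod_const, Finset.card_univ, Fintype.card_fin,
      card_neighborhoods, ← pow_mul]
    exact Nat.pow_le_pow_left G.card_colorValues_le _
  have hsub : G.keys l S ⊆
      S.powerset.biUnion fun X => (Finset.range (S.card - X.card + 1)).biUnion (lists X) := by
    intro K hK
    obtain ⟨A, hA, rfl⟩ := Finset.mem_image.1 hK
    have hA : IsBalanced S A := by simpa using hA
    simp only [Finset.mem_biUnion, Finset.mem_powerset, Finset.mem_range]
    refine ⟨A ∩ S, Finset.inter_subset_right, (G.positionKey l S A).2.length, ?_, ?_⟩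
    · have h1 : (G.positionKey l S A).2.length ≤ ((Finset.univ \ S) \ A).card := by
        rw [positionKey, List.length_map, ← List.toFinset_card_of_nodup (hl.filter _)]
        refine Finset.card_le_card fun v hv => ?_
        simp at hv
        simp [hv]
      have h2 : (S \ A).card + (S ∩ A).card = S.card := Finset.card_sdiff_add_card_inter S A
      rw [Finset.inter_comm]
      unfold IsBalanced at hA
      omega
    · refine Finset.mem_image.2 ⟨fun i => (G.positionKey l S A).2.get i, ?_, ?_⟩
      · rw [Fintype.mem_piFinset]
        intro i
        have := List.get_mem (G.positionKey l S A).2 i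
        simp only [positionKey, List.mem_map] at this
        obtain ⟨v, -, hv⟩ := this
        simp only [positionKey] at hv ⊢
        rw [← hv]
        exact G.colorsTo_mem_neighborhoods _ v
      · rw [List.ofFn_get]
        rfl
  -- For each length k the exponent is xk ≤ (x + k)²/4 ≤ s²/4, and the number of lengths is s - x +
  -- 1 ≤ 2^(s-x). The factor 1^x prepares the binomial theorem for (1 + 2)^s.
  have hX : ∀ X ∈ S.powerset, ((Finset.range (S.card - X.card + 1)).biUnion (lists X)).card ≤
      c ^ (S.card ^ 2 / 4) * (1 ^ X.card * 2 ^ (S.card - X.card)) := by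
    intro X hX
    have hXS := Finset.card_le_card (Finset.mem_powerset.1 hX)
    refine (Finset.card_biUnion_le_card_mul _ _ (c ^ (S.card ^ 2 / 4)) fun k hk => ?_).trans ?_
    · refine (hlists X k).trans (Nat.pow_le_pow_right (by omega) ?_)
      rw [Nat.le_div_iff_mul_le (by norm_num)]
      have hk : X.card + k ≤ S.card := by
        have := Finset.mem_range.1 hk
        omega
      nlinarith [sq_nonneg ((X.card : ℤ) - k), four_mul_le_sq_add X.card k, Nat.pow_le_pow_left hk 2]
    · rw [Finset.card_range, one_pow, one_mul, mul_comm]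
      exact Nat.mul_le_mul_left _ (Nat.lt_two_pow_self)
  calc (G.keys l S).card ≤ _ := Finset.card_le_card hsub
    _ ≤ ∑ X ∈ S.powerset, _ := Finset.card_biUnion_le
    _ ≤ ∑ X ∈ S.powerset, c ^ (S.card ^ 2 / 4) * (1 ^ X.card * 2 ^ (S.card - X.card)) :=
      Finset.sum_le_sum hX
    _ = _ := by rw [← Finset.mul_sum, Finset.sum_pow_mul_eq_add_pow]

/-- The key of a chosen representative is an injective invariant of the class, and reachable
positions are balanced. -/
theorem numPositions_le {S : Finset V} (hS : G.graph.IsVertexCover (S : Set V)) :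
    G.numPositions S ≤ (G.numColors + 1) ^ (S.card ^ 2 / 4) * 3 ^ S.card := by
  have hl := (Finset.univ : Finset V).nodup_toList
  refine le_trans ?_ (G.card_keys_le hl S)
  rw [numPositions, ← Nat.card_eq_finsetCard]
  refine Nat.card_le_card_of_injective (fun Q => ⟨G.positionKey Finset.univ.toList S Q.out.1,
    G.mem_keys _ (Q.out.2.choose_spec.isBalanced hS)⟩) fun Q Q' h => ?_
  have := samePosition_of_positionKey_eq hl (by simp) hS (congrArg Subtype.val h)
  rw [← Q.out_eq, ← Q'.out_eq]
  exact Quotient.sound this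

end ColoredGraph

/-! ### From the rounded-down natural exponent to the real one -/

theorem pow_div_four_le_rpow (c s : ℕ) :
    (((c + 1) ^ (s ^ 2 / 4) : ℕ) : ℝ) ≤ ((c : ℝ) + 1) ^ ((s : ℝ) ^ 2 / 4) := by
  push_cast
  rw [← Real.rpow_natCast]
  refine Real.rpow_le_rpow_of_exponent_le (by linarith [(Nat.cast_nonneg c : (0 : ℝ) ≤ c)]) ?_
  refine Nat.cast_div_le.trans ?_
  push_cast
  rfl

theorem ColoredGraph.numPositions_le_rpow {V : Type*} [Fintype V] [DecidableEq V]
    (G : ColoredGraph V) {S : Finset V} (hS : G.graph.IsVertexCover (S : Set V))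
    (hne : S.Nonempty) :
    (G.numPositions S : ℝ) ≤
      ((G.numColors : ℝ) + 1) ^ ((S.card : ℝ) ^ 2 / 4) * 3 ^ S.card * (S.card : ℝ) ^ 2 := by
  -- The factor |S|² is pure slack; it is at least 1 because S is non-empty.
  have h1 : (1 : ℝ) ≤ (S.card : ℝ) ^ 2 := one_le_pow₀ (by exact_mod_cast hne.card_pos)
  have h2 : (G.numPositions S : ℝ) ≤ _ := Nat.cast_le.2 (G.numPositions_le hS)
  refine h2.trans ?_
  rw [Nat.cast_mul]
  refine le_trans ?_ (le_mul_of_one_le_right (by positivity) h1)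
  push_cast
  gcongr
  exact_mod_cast pow_div_four_le_rpow G.numColors S.card

/-! ### Programs -/

namespace Data

/-- The first component; the value of `head`. -/
def hd : Data → Data
  | nil => nil
  | cons a _ => a

/-- The second component; the value of `tail`. -/
def tl : Data → Data
  | nil => nil
  | cons _ b => b

@[simp] theorem hd_nil : nil.hd = nil := rfl

@[simp] theorem tl_nil : nil.tl = nil := rfl

@[simp] theorem hd_cons (a b : Data) : (cons a b).hd = a := rfl

@[simp] theorem tl_cons (a b : Data) : (cons a b).tl = b := rfl

/-- The length of a list; lists also serve as unary numbers. -/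
def len : Data → ℕ
  | nil => 0
  | cons _ b => b.len + 1

@[simp] theorem len_nil : nil.len = 0 := rfl

@[simp] theorem len_cons (a b : Data) : (cons a b).len = b.len + 1 := rfl

/-- The entries of a list. -/
def nth (d : Data) : ℕ → Data
  | 0 => d.hd
  | i + 1 => d.tl.nth i

@[simp] theorem nth_nil (i : ℕ) : nil.nth i = nil := by
  induction i with
  | zero => rfl
  | succ i ih => exact ih

/-- Replace an entry of a list. -/
def upd (d : Data) (v : Data) : ℕ → Data
  | 0 => cons v d.tl
  | i + 1 => cons d.hd (d.tl.upd v i)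

theorem nth_upd (d v : Data) (i j : ℕ) : (d.upd v i).nth j = if j = i then v else d.nth j := by
  induction i generalizing d j with
  | zero => cases j <;> simp [upd, nth]
  | succ i ih => cases j <;> simp [upd, nth, ih]

theorem nth_encodeList_ofFn {n : ℕ} (f : Fin n → Data) (i : Fin n) :
    (encodeList (List.ofFn f)).nth i = f i := by
  induction n with
  | zero => exact i.elim0
  | succ n ih =>
    rw [List.ofFn_succ]
    cases i using Fin.cases with
    | zero => rfl
    | succ i => exact ih _ i

theorem len_encodeList (l : List Data) : (encodeList l).len = l.length := by
  induction l with
  | nil => rfl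
  | cons a l ih => simp [encodeList, ih]

/-- Look up an entry of a binary trie. A node consists of its value and its two subtries. -/
def get (d : Data) : List Bool → Data
  | [] => d.hd
  | b :: k => if b then d.tl.hd.get k else d.tl.tl.get k

/-- Set an entry of a binary trie. -/
def put (d v : Data) : List Bool → Data
  | [] => cons v d.tl
  | b :: k =>
    cons d.hd (if b then cons (d.tl.hd.put v k) d.tl.tl else cons d.tl.hd (d.tl.tl.put v k))

@[simp] theorem get_nil (k : List Bool) : nil.get k = nil := by
  induction k with
  | nil => rfl
  | cons b k ih => cases b <;> simp [get, ih]

/-- Values are stored at inner nodes too, so keys of different lengths may be prefixes of each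
other. -/
theorem get_put (d v : Data) (k k' : List Bool) :
    (d.put v k).get k' = if k' = k then v else d.get k' := by
  induction k generalizing d k' with
  | nil => cases k' <;> simp [put, get]
  | cons b k ih =>
    cases k' with
    | nil => simp [put, get]
    | cons b' k' => cases b <;> cases b' <;> simp [put, get, ih]

end Data

/-- Lists of truth values as data. -/
def encodeBits (k : List Bool) : Data := encodeList (k.map encodeBool)

@[simp] theorem encodeBits_nil : encodeBits [] = .nil := rfl

@[simp] theorem encodeBits_cons (b : Bool) (k : List Bool) :
    encodeBits (b :: k) = .cons (encodeBool b) (encodeBits k) := rfl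

@[simp] theorem encodeBool_eq_nil {b : Bool} : encodeBool b = .nil ↔ b = false := by
  cases b <;> simp [encodeBool]

namespace Code

/-- The truth value `true`. -/
def one : Code := cons nil nil

/-- Second component of a tuple. -/
def snd (a : Code) : Code := head (tail a)

/-- Rest of a tuple after two components. -/
def tail2 (a : Code) : Code := tail (tail a)

/-- Rest of a tuple after three components. -/
def tail3 (a : Code) : Code := tail (tail2 a)

/-- Rest of a tuple after four components. -/
def tail4 (a : Code) : Code := tail2 (tail2 a)

end Code

/-! ### The functions of the program -/

open Code in
/-- `nth (d, i)`: an entry of a list. -/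
def nthCode : Code :=
  ite (tail arg) (call 1 (cons (tail (head arg)) (tail2 arg))) (head (head arg))

open Code in
/-- `upd (d, i, v)`: replace an entry of a list. -/
def updCode : Code :=
  ite (snd arg)
    (cons (head (head arg)) (call 2 (cons (tail (head arg)) (cons (tail (snd arg)) (tail2 arg)))))
    (cons (tail2 arg) (tail (head arg)))

open Code in
/-- `get (d, k)`: look up an entry of a trie. -/
def getCode : Code :=
  ite (tail arg)
    (ite (snd arg) (call 3 (cons (snd (head arg)) (tail2 arg)))
      (call 3 (cons (tail2 (head arg)) (tail2 arg))))
    (head (head arg))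

open Code in
/-- `put (d, k, v)`: set an entry of a trie. -/
def putCode : Code :=
  ite (snd arg)
    (cons (head (head arg))
      (ite (head (snd arg))
        (cons (call 4 (cons (snd (head arg)) (cons (tail (snd arg)) (tail2 arg))))
          (tail2 (head arg)))
        (cons (snd (head arg))
          (call 4 (cons (tail2 (head arg)) (cons (tail (snd arg)) (tail2 arg)))))))
    (cons (tail2 arg) (tail (head arg)))

open Code in
/-- The colour of the edge from the vertex `i` to the vertex `v` if `i` belongs to `a` and `s`, in
the context `(i + 1, acc, v, a, M, s)`. -/
def edgeCode : Code :=
  ite (call 1 (cons (tail (tail4 arg)) (tail (head arg))))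
    (ite (call 1 (cons (snd (tail2 arg)) (tail (head arg))))
      (call 1 (cons (call 1 (cons (head (tail4 arg)) (tail (head arg)))) (head (tail2 arg))))
      nil)
    nil

open Code in
/-- `neighbors (i, acc, v, a, M, s)`: the colours of the edges between `v` and the vertices below
`i` in `a` and `s`, followed by `acc`. -/
def neighborsCode : Code :=
  ite (head arg)
    (cons (head edgeCode) (cons (tail edgeCode) (call 5 (cons (tail (head arg)) (tail arg)))))
    (snd arg)

open Code in
/-- `blocks (i, a, M, s)`: the neighbourhoods of the vertices below `i` outside `a` and `s`. -/
def blocksCode : Code :=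
  ite (head arg)
    (ite (call 1 (cons (tail3 arg) (tail (head arg))))
      (call 6 (cons (tail (head arg)) (tail arg)))
      (ite (call 1 (cons (snd arg) (tail (head arg))))
        (call 6 (cons (tail (head arg)) (tail arg)))
        (cons nil (call 5 (cons (snd (tail arg))
          (cons (call 6 (cons (tail (head arg)) (tail arg)))
            (cons (tail (head arg)) (tail arg))))))))
    nil

open Code in
/-- `members (i, acc, a, s)`: for the vertices below `i`, whether they belong to `a` and `s`,
followed by `acc`. -/
def membersCode : Code :=
  ite (head arg)
    (cons
      (ite (call 1 (cons (tail3 arg) (tail (head arg))))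
        (ite (call 1 (cons (snd (tail arg)) (tail (head arg)))) one nil) nil)
      (call 7 (cons (tail (head arg)) (tail arg))))
    (snd arg)

open Code in
/-- `key (p, a, M, s)`: the key of a position. -/
def keyCode : Code :=
  cons (head arg) (call 7 (cons (head (tail2 arg))
    (cons (call 6 (cons (head (tail2 arg)) (tail arg))) (cons (snd arg) (tail3 arg)))))

open Code in
/-- `solve (m, p, a, E, M, s)`: whether the player `p` wins in the position `a`, and the memo. -/
def solveCode : Code :=
  call 10 (cons (call 8 (cons (snd arg) (cons (head (tail2 arg)) (tail4 arg)))) arg)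

open Code in
/-- `solve` with the key of the position as an additional first argument. -/
def solveKeyCode : Code :=
  call 11 (cons (call 3 (cons (snd arg) (head arg))) arg)

open Code in
/-- `solve` with the memoized value and the key as additional first arguments. -/
def solveMemoCode : Code :=
  ite (head arg) (cons (head arg) (head (tail2 arg)))
    (call 12 (cons (snd arg) (call 13 (cons (snd (tail4 arg)) (tail2 arg)))))

open Code in
/-- `store (k, b, m)`: memoize the value `b` under the key `k`. -/
def storeCode : Code :=
  cons (cons (snd arg) nil) (call 4 (cons (tail2 arg) (cons (head arg) (cons (snd arg) nil))))

open Code in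
/-- Whether `p` may select the first pair from `L`, in the context `(L, m, p, a, E, M, s)`. -/
def selectsCode : Code :=
  ite (head (tail2 arg)) (head (head (head (head arg)))) (tail (head (head (head arg))))

open Code in
/-- Whether the first pair from `L` is a move, in the context `(L, m, p, a, E, M, s)`. -/
def moveCode : Code :=
  ite selectsCode
    (ite (call 1 (cons (snd (tail2 arg)) (snd (head (head arg)))))
      (call 1 (cons (snd (tail2 arg)) (tail2 (head (head arg))))) nil) nil

open Code in
/-- The opponent of `p`, in the context `(L, m, p, a, E, M, s)`. -/
def otherCode : Code := ite (head (tail2 arg)) nil one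

open Code in
/-- `loop (L, m, p, a, E, M, s)`: whether some move along a pair from `L` wins, and the memo. -/
def loopCode : Code :=
  ite (head arg)
    (ite moveCode
      (call 14 (cons (call 9 (cons (snd arg) (cons otherCode
        (cons (call 2 (cons (call 2 (cons (snd (tail2 arg)) (cons (snd (head (head arg))) nil)))
          (cons (tail2 (head (head arg))) nil))) (tail4 arg))))) arg))
      (call 13 (cons (tail (head arg)) (tail arg))))
    (cons nil (snd arg))

open Code in
/-- Continue `loop`, given the value of a move. -/
def loopNextCode : Code :=
  ite (head (head (head arg)))
    (call 13 (cons (tail (snd arg)) (cons (tail (head arg)) (tail3 arg))))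
    (cons one (tail (head arg)))

open Code in
/-- `cover (L, s, k)`: a set that contains `s`, at most `k` further vertices and an endpoint of each
edge in `L`. -/
def coverCode : Code :=
  ite (head arg)
    (ite (head (head (head arg)))
      (ite (call 1 (cons (snd arg) (snd (head (head arg)))))
        (call 15 (cons (tail (head arg)) (tail arg)))
        (ite (call 1 (cons (snd arg) (tail2 (head (head arg)))))
          (call 15 (cons (tail (head arg)) (tail arg)))
          (ite (tail2 arg)
            (call 16 (cons
              (call 15 (cons (tail (head arg))
                (cons (call 2 (cons (snd arg) (cons (snd (head (head arg))) one)))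
                  (tail3 arg))))
              (cons (tail (head arg))
                (cons (call 2 (cons (snd arg) (cons (tail2 (head (head arg))) one)))
                  (tail3 arg)))))
            nil)))
      (call 15 (cons (tail (head arg)) (tail arg))))
    (cons (snd arg) nil)

open Code in
/-- The first argument if it is not `nil`, and otherwise `cover` of the others. -/
def coverOrCode : Code := ite (head arg) (head arg) (call 15 (tail arg))

open Code in
/-- `find (E, k)`: a smallest vertex cover if it has at least `k` elements. -/
def findCode : Code := call 18 (cons (call 15 (cons (head arg) (cons nil (tail arg)))) arg)

open Code in
/-- Continue `find`, given the result of `cover`. -/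
def findNextCode : Code :=
  ite (head arg) (head (head arg)) (call 17 (cons (snd arg) (cons nil (tail2 arg))))

open Code in
/-- `row (i, acc, u, M)`: the pairs of `u` and vertices below `i`, followed by `acc`. -/
def rowCode : Code :=
  ite (head arg)
    (cons (cons (call 1 (cons (call 1 (cons (tail3 arg) (head (tail2 arg)))) (tail (head arg))))
        (cons (head (tail2 arg)) (tail (head arg))))
      (call 19 (cons (tail (head arg)) (tail arg))))
    (snd arg)

open Code in
/-- `rows (i, M)`: the pairs of a vertex below `i` and a vertex. -/
def rowsCode : Code :=
  ite (head arg)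
    (call 19 (cons (tail arg)
      (cons (call 20 (cons (tail (head arg)) (tail arg))) (cons (tail (head arg)) (tail arg)))))
    nil

open Code in
/-- The main function `(p, M)`. -/
def mainCode : Code :=
  call 21 (cons (head arg) (cons (call 20 (cons (tail arg) (tail arg))) (tail arg)))

open Code in
/-- The main function `(p, E, M)` with the list of pairs as an additional argument. -/
def mainEdgesCode : Code :=
  head (head (call 9 (cons nil (cons (head arg) (cons (tail2 arg) (cons (snd arg)
    (cons (tail2 arg) (call 17 (cons (snd arg) nil)))))))))

/-- The program that determines the winner. -/
def prog : Program :=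
  [mainCode, nthCode, updCode, getCode, putCode, neighborsCode, blocksCode, membersCode, keyCode,
    solveCode, solveKeyCode, solveMemoCode, storeCode, loopCode, loopNextCode, coverCode,
    coverOrCode, findCode, findNextCode, rowCode, rowsCode, mainEdgesCode]

/-! ### Reasoning about programs -/

/-- On the argument `v`, the function `f` halts with an output and a running time in `Q`. -/
def Computes (f : ℕ) (v : Data) (Q : Data → ℕ → Prop) : Prop :=
  ∃ body y t, prog[f]? = some body ∧ Eval prog v body y t ∧ Q y t

theorem Computes.mono {f : ℕ} {v : Data} {Q Q' : Data → ℕ → Prop} (h : Computes f v Q)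
    (hQ : ∀ y t, Q y t → Q' y t) : Computes f v Q' := by
  obtain ⟨body, y, t, hb, he, hq⟩ := h
  exact ⟨body, y, t, hb, he, hQ y t hq⟩

/-- The weakest precondition for an expression to halt with an output and a running time in
`Q`. -/
def wp (x : Data) : Code → (Data → ℕ → Prop) → Prop
  | .arg, Q => Q x 1
  | .nil, Q => Q .nil 1
  | .cons a b, Q => wp x a fun v s => wp x b fun w t => Q (.cons v w) (s + t + 1)
  | .head a, Q => wp x a fun v s => Q v.hd (s + 1)
  | .tail a, Q => wp x a fun v s => Q v.tl (s + 1)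
  | .ite c a b, Q => wp x c fun v s =>
      (v = .nil → wp x b fun y t => Q y (s + t + 1)) ∧
        (v ≠ .nil → wp x a fun y t => Q y (s + t + 1))
  | .call f a, Q => wp x a fun v s => Computes f v fun y t => Q y (s + t + 1)

/-- Structural induction suffices since `wp` does not unfold calls: a call demands a `Computes`
statement, which each recursive function obtains by its own induction on data or positions. -/
theorem exists_eval_of_wp {x : Data} {e : Code} {Q : Data → ℕ → Prop} (h : wp x e Q) :
    ∃ y t, Eval prog x e y t ∧ Q y t := by
  induction e generalizing Q with
  | arg => exact ⟨_, _, .arg, h⟩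
  | nil => exact ⟨_, _, .nil, h⟩
  | cons a b iha ihb =>
    obtain ⟨v, s, ha, h⟩ := iha h
    obtain ⟨w, t, hb, h⟩ := ihb h
    exact ⟨_, _, .cons ha hb, h⟩
  | head a ih =>
    obtain ⟨v, s, ha, h⟩ := ih h
    cases v with
    | nil => exact ⟨_, _, .head_nil ha, h⟩
    | cons v w => exact ⟨_, _, .head_cons ha, h⟩
  | tail a ih =>
    obtain ⟨v, s, ha, h⟩ := ih h
    cases v with
    | nil => exact ⟨_, _, .tail_nil ha, h⟩
    | cons v w => exact ⟨_, _, .tail_cons ha, h⟩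
  | ite c a b ihc iha ihb =>
    obtain ⟨v, s, hc, h⟩ := ihc h
    cases v with
    | nil =>
      obtain ⟨y, t, hb, h⟩ := ihb (h.1 rfl)
      exact ⟨_, _, .ite_nil hc hb, h⟩
    | cons v w =>
      obtain ⟨y, t, ha, h⟩ := iha (h.2 (by simp))
      exact ⟨_, _, .ite_cons hc ha, h⟩
  | call f a ih =>
    obtain ⟨v, s, ha, body, y, t, hb, he, h⟩ := ih h
    exact ⟨_, _, .call hb ha he, h⟩

theorem computes_of_wp {f : ℕ} {v : Data} {Q : Data → ℕ → Prop} (body : Code)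
    (hf : prog[f]? = some body) (h : wp v body Q) : Computes f v Q := by
  obtain ⟨y, t, he, hq⟩ := exists_eval_of_wp h
  exact ⟨body, y, t, hf, he, hq⟩

/-! ### Lists and tries -/

/-- Here and below, the constants in the time bounds are generous upper bounds for the elementary
steps of one round of the recursion. -/
theorem computes_nth (d i : Data) :
    Computes 1 (.cons d i) fun y t => y = d.nth i.len ∧ t ≤ 20 * (i.len + 1) := by
  induction i generalizing d with
  | nil =>
    apply computes_of_wp nthCode rfl
    simp [wp, nthCode, Code.tail2, Data.nth]
  | cons a i _ ih =>
    apply computes_of_wp nthCode rfl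
    simp only [wp, nthCode, Code.tail2, Data.tl_cons, Data.hd_cons]
    refine ⟨by simp, fun _ => (ih d.tl).mono ?_⟩
    rintro y t ⟨rfl, ht⟩
    refine ⟨rfl, ?_⟩
    simp only [Data.len_cons]
    omega

theorem computes_upd (d i v : Data) :
    Computes 2 (.cons d (.cons i v)) fun y t => y = d.upd v i.len ∧ t ≤ 40 * (i.len + 1) := by
  induction i generalizing d with
  | nil =>
    apply computes_of_wp updCode rfl
    simp [wp, updCode, Code.snd, Code.tail2, Data.upd]
  | cons a i _ ih =>
    apply computes_of_wp updCode rfl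
    simp only [wp, updCode, Code.snd, Code.tail2, Data.tl_cons, Data.hd_cons]
    refine ⟨by simp, fun _ => (ih d.tl).mono ?_⟩
    rintro y t ⟨rfl, ht⟩
    refine ⟨rfl, ?_⟩
    simp only [Data.len_cons]
    omega

theorem computes_get (d : Data) (k : List Bool) :
    Computes 3 (.cons d (encodeBits k)) fun y t => y = d.get k ∧ t ≤ 40 * (k.length + 1) := by
  induction k generalizing d with
  | nil =>
    apply computes_of_wp getCode rfl
    simp [wp, getCode, Code.snd, Code.tail2, Data.get]
  | cons b k ih =>
    apply computes_of_wp getCode rfl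
    simp only [wp, getCode, Code.snd, Code.tail2, Data.tl_cons, Data.hd_cons, encodeBits_cons,
      encodeBool_eq_nil]
    refine ⟨by simp, fun _ => ⟨fun hb => (ih d.tl.tl).mono ?_, fun hb => (ih d.tl.hd).mono ?_⟩⟩
    all_goals
      rintro y t ⟨rfl, ht⟩
      refine ⟨by cases b <;> simp_all [Data.get], ?_⟩
      simp only [List.length_cons]
      omega

theorem computes_put (d v : Data) (k : List Bool) :
    Computes 4 (.cons d (.cons (encodeBits k) v)) fun y t =>
      y = d.put v k ∧ t ≤ 60 * (k.length + 1) := by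
  induction k generalizing d with
  | nil =>
    apply computes_of_wp putCode rfl
    simp [wp, putCode, Code.snd, Code.tail2, Data.put]
  | cons b k ih =>
    apply computes_of_wp putCode rfl
    simp only [wp, putCode, Code.snd, Code.tail2, Data.tl_cons, Data.hd_cons, encodeBits_cons,
      encodeBool_eq_nil]
    refine ⟨by simp, fun _ => ⟨fun hb => (ih d.tl.tl).mono ?_, fun hb => (ih d.tl.hd).mono ?_⟩⟩
    all_goals
      rintro y t ⟨rfl, ht⟩
      refine ⟨by cases b <;> simp_all [Data.put], ?_⟩
      simp only [List.length_cons]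
      omega

/-! ### Keys of positions -/

/-- The vertices below `m`, in descending order. -/
def verticesBelow (n : ℕ) : ℕ → List (Fin n)
  | 0 => []
  | m + 1 => if h : m < n then ⟨m, h⟩ :: verticesBelow n m else verticesBelow n m

theorem verticesBelow_succ {n : ℕ} (v : Fin n) :
    verticesBelow n (v + 1) = v :: verticesBelow n v := by
  simp [verticesBelow]

theorem mem_verticesBelow {n m : ℕ} {v : Fin n} : v ∈ verticesBelow n m ↔ (v : ℕ) < m := by
  induction m with
  | zero => simp [verticesBelow]
  | succ m ih =>
    rw [verticesBelow]
    split_ifs with h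
    · rw [List.mem_cons, ih, Fin.ext_iff]
      simp only
      omega
    · rw [ih]
      omega

theorem nodup_verticesBelow (n m : ℕ) : (verticesBelow n m).Nodup := by
  induction m with
  | zero => simp [verticesBelow]
  | succ m ih =>
    rw [verticesBelow]
    split_ifs with h
    · exact List.nodup_cons.2 ⟨by simp [mem_verticesBelow], ih⟩
    · exact ih

theorem length_verticesBelow_le (n m : ℕ) : (verticesBelow n m).length ≤ m := by
  induction m with
  | zero => simp [verticesBelow]
  | succ m ih =>
    rw [verticesBelow]
    split_ifs with h
    · simpa using ih
    · exact ih.trans (Nat.le_succ m)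

/-! ### Keys as bit strings -/

/-- Whether the player may select an edge. -/
def Player.selects : Player → Option EdgeColor → Bool
  | .black, some .gray => true
  | .black, some .black => true
  | .white, some .gray => true
  | .white, some .white => true
  | _, _ => false

theorem Player.selects_iff {p : Player} {c : Option EdgeColor} :
    p.selects c = true ↔ ∃ c', c = some c' ∧ p.MaySelect c' := by
  cases p <;> rcases c with _ | _ | _ | _ <;> simp [Player.selects, Player.MaySelect]

theorem hd_encodeEntry (c : Option EdgeColor) :
    (encodeEntry c).hd = encodeBool (Player.black.selects c) := by
  rcases c with _ | _ | _ | _ <;> rfl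

theorem tl_encodeEntry (c : Option EdgeColor) :
    (encodeEntry c).tl = encodeBool (Player.white.selects c) := by
  rcases c with _ | _ | _ | _ <;> rfl

theorem eq_of_selects_eq {c d : Option EdgeColor} (h : ∀ p : Player, p.selects c = p.selects d) :
    c = d := by
  have h1 := h .black
  have h2 := h .white
  rcases c with _ | _ | _ | _ <;> rcases d with _ | _ | _ | _ <;> simp_all [Player.selects]

/-- Players as truth values. -/
def Player.toBool : Player → Bool
  | .black => true
  | .white => false

theorem encodePlayer_eq (p : Player) : encodePlayer p = encodeBool p.toBool := by
  cases p <;> rfl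

theorem Player.toBool_injective : Function.Injective Player.toBool := by
  intro p q h
  cases p <;> cases q <;> simp_all [Player.toBool]

section Keys

variable {n : ℕ}

/-- The edges from a vertex to the vertices below `m`. -/
def neighborBits (m : ℕ) (t : Fin n → Option EdgeColor) : List Bool :=
  (verticesBelow n m).flatMap fun u => [Player.black.selects (t u), Player.white.selects (t u)]

theorem length_neighborBits (m : ℕ) (t : Fin n → Option EdgeColor) :
    (neighborBits m t).length = (verticesBelow n m).length * 2 := by
  simp [neighborBits, List.length_flatMap]

theorem neighborBits_injective :
    Function.Injective (neighborBits n : (Fin n → Option EdgeColor) → List Bool) := by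
  intro t t' h
  have hl : ∀ l : List (Fin n),
      l.flatMap (fun u => [Player.black.selects (t u), Player.white.selects (t u)]) =
        l.flatMap (fun u => [Player.black.selects (t' u), Player.white.selects (t' u)]) →
      ∀ u ∈ l, t u = t' u := by
    intro l
    induction l with
    | nil => simp
    | cons a l ih =>
      intro h u hu
      simp only [List.flatMap_cons, List.cons_append, List.nil_append, List.cons.injEq] at h
      rcases List.mem_cons.1 hu with rfl | hu
      · exact eq_of_selects_eq fun p => by cases p <;> simp [h.1, h.2.1]
      · exact ih h.2.2 u hu
  ext1 u
  exact hl _ h u (mem_verticesBelow.2 u.2)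

/-- The list of the edges to the removed vertices, with separators. -/
def typeBits (l : List (Fin n → Option EdgeColor)) : List Bool :=
  l.flatMap fun t => false :: neighborBits n t

/-- All blocks have the same length, so the string can be cut uniquely. The leading bit makes them
non-empty even for n = 0, so the number of blocks is not lost. -/
theorem typeBits_injective :
    Function.Injective (typeBits : List (Fin n → Option EdgeColor) → List Bool) := by
  intro l
  induction l with
  | nil =>
    intro l' h
    cases l' with
    | nil => rfl
    | cons t l' => simp [typeBits] at h
  | cons t l ih =>
    intro l' h
    cases l' with
    | nil => simp [typeBits] at h
    | cons t' l' =>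
      simp only [typeBits, List.flatMap_cons, List.cons_append, List.cons.injEq, true_and] at h
      obtain ⟨h1, h2⟩ := List.append_inj h (by rw [length_neighborBits, length_neighborBits])
      rw [neighborBits_injective h1, ih h2]

/-- The key of a position as a list of truth values. -/
def keyBits (p : Player) (K : Finset (Fin n) × List (Fin n → Option EdgeColor)) : List Bool :=
  p.toBool :: ((verticesBelow n n).map (fun v => decide (v ∈ K.1)) ++ typeBits K.2)

theorem keyBits_injective {p q : Player}
    {K L : Finset (Fin n) × List (Fin n → Option EdgeColor)} (h : keyBits p K = keyBits q L) :
    p = q ∧ K = L := by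
  simp only [keyBits, List.cons.injEq] at h
  obtain ⟨h1, h2⟩ := List.append_inj h.2 (by simp)
  refine ⟨Player.toBool_injective h.1, Prod.ext (Finset.ext fun v => ?_) (typeBits_injective h2)⟩
  have := List.map_inj_left.1 h1 v (mem_verticesBelow.2 v.2)
  simpa using this

variable (G : ColoredGraph (Fin n))

/-- The key of a position as a list of truth values. -/
def ColoredGraph.bitKey (S : Finset (Fin n)) (p : Player) (A : Finset (Fin n)) : List Bool :=
  keyBits p (G.positionKey (verticesBelow n n) S A)

variable {G}

theorem ColoredGraph.samePosition_of_bitKey_eq {S A B : Finset (Fin n)}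
    (hS : G.graph.IsVertexCover (S : Set (Fin n))) {p q : Player}
    (h : G.bitKey S p A = G.bitKey S q B) : p = q ∧ G.SamePosition S A B := by
  obtain ⟨hp, hK⟩ := keyBits_injective h
  exact ⟨hp, samePosition_of_positionKey_eq (nodup_verticesBelow n n)
    (fun v => mem_verticesBelow.2 v.2) hS hK⟩

theorem ColoredGraph.length_bitKey_le (S : Finset (Fin n)) (p : Player) (A : Finset (Fin n)) :
    (G.bitKey S p A).length + 1 ≤ 2 * (n + 1) ^ 2 := by
  have h1 : (G.positionKey (verticesBelow n n) S A).2.length ≤ n := by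
    rw [positionKey, List.length_map]
    exact (List.length_filter_le _ _).trans (length_verticesBelow_le n n)
  have h2 := length_verticesBelow_le n n
  have h3 : (typeBits (G.positionKey (verticesBelow n n) S A).2).length ≤ n * (n * 2 + 1) := by
    simp only [typeBits, List.length_flatMap, List.length_cons, length_neighborBits]
    simp only [List.map_const', List.sum_replicate, smul_eq_mul]
    gcongr
  simp only [bitKey, keyBits, List.length_cons, List.length_append, List.length_map]
  nlinarith

/-- The tuple of data `a` represents the set `A`. -/
def Represents (a : Data) (A : Finset (Fin n)) : Prop :=
  ∀ i : Fin n, a.nth i = .nil ↔ i ∉ A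

theorem Represents.upd_nil {a : Data} {A : Finset (Fin n)} (h : Represents a A) (u : Fin n) :
    Represents (a.upd .nil u) (A.erase u) := by
  intro i
  rw [Data.nth_upd]
  split_ifs with hi
  · simp [Fin.ext hi]
  · simp [h i, Fin.ext_iff, hi]

theorem Represents.upd_cons {a : Data} {A : Finset (Fin n)} (h : Represents a A) (u : Fin n)
    (x y : Data) : Represents (a.upd (.cons x y) u) (insert u A) := by
  intro i
  rw [Data.nth_upd]
  split_ifs with hi
  · simp [Fin.ext hi]
  · simp [h i, Fin.ext_iff, hi]

/-- `M` is the coloured adjacency matrix of `G`. -/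
structure IsMatrix (G : ColoredGraph (Fin n)) (M : Data) : Prop where
  len : M.len = n
  row : ∀ u : Fin n, M.nth u ≠ .nil
  nth : ∀ u v : Fin n, (M.nth u).nth v = encodeEntry (G.color u v)

theorem isMatrix_encode (G : ColoredGraph (Fin n)) : IsMatrix G
    (encodeList (List.ofFn fun i => encodeList (List.ofFn fun j => encodeEntry (G.color i j)))) :=
  ⟨by simp [Data.len_encodeList], fun u => by
    obtain _ | n := n
    · exact u.elim0
    · rw [Data.nth_encodeList_ofFn, List.ofFn_succ, encodeList]
      simp, fun u v => by
    rw [Data.nth_encodeList_ofFn, Data.nth_encodeList_ofFn]⟩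

/-- The matrix itself serves as the full vertex set, since none of its rows is `nil`. -/
theorem IsMatrix.represents_univ {M : Data} (hM : IsMatrix G M) :
    Represents M (Finset.univ : Finset (Fin n)) := by
  intro i
  simp [hM.row i]

/-! ### Computing the key -/

variable {M s a : Data} {S A : Finset (Fin n)}

theorem wp_edgeCode (hM : IsMatrix G M) (hs : Represents s S) (ha : Represents a A)
    (x acc i v : Data) (hi : i.len < n) (hv : v.len < n) {Q : Data → ℕ → Prop}
    (hQ : ∀ t ≤ 100 * (n + 1), Q (encodeEntry (G.colorsTo (A ∩ S) ⟨v.len, hv⟩ ⟨i.len, hi⟩)) t) :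
    wp (.cons (.cons x i) (.cons acc (.cons v (.cons a (.cons M s))))) edgeCode Q := by
  simp only [wp, edgeCode, Code.snd, Code.tail2, Code.tail4, Data.tl_cons, Data.hd_cons]
  refine (computes_nth s i).mono ?_
  rintro y t ⟨rfl, ht⟩
  have hsi := hs ⟨i.len, hi⟩
  have hai := ha ⟨i.len, hi⟩
  simp only at hsi hai
  refine ⟨fun h => ?_, fun h => (computes_nth a i).mono ?_⟩
  · rw [hsi] at h
    simp only [ColoredGraph.colorsTo, Finset.mem_inter, h, and_false, if_false, encodeEntry] at hQ
    exact hQ _ (by omega)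
  · rintro y t' ⟨rfl, ht'⟩
    rw [ne_eq, hsi, not_not] at h
    refine ⟨fun h' => ?_, fun h' => (computes_nth M i).mono ?_⟩
    · rw [hai] at h'
      simp only [ColoredGraph.colorsTo, Finset.mem_inter, h', false_and, if_false,
        encodeEntry] at hQ
      exact hQ _ (by omega)
    · rw [ne_eq, hai, not_not] at h'
      rintro y t1 ⟨rfl, ht1⟩
      refine (computes_nth _ v).mono ?_
      rintro y t2 ⟨rfl, ht2⟩
      have := hM.nth ⟨i.len, hi⟩ ⟨v.len, hv⟩
      simp only at this
      simp only [ColoredGraph.colorsTo, Finset.mem_inter, h, h', and_self, if_true, ← this] at hQ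
      exact hQ _ (by omega)

theorem computes_neighbors (hM : IsMatrix G M) (hs : Represents s S) (ha : Represents a A)
    (i v : Data) (acc : List Bool) (hi : i.len ≤ n) (hv : v.len < n) :
    Computes 5 (.cons i (.cons (encodeBits acc) (.cons v (.cons a (.cons M s))))) fun y t =>
      y = encodeBits (neighborBits i.len (G.colorsTo (A ∩ S) ⟨v.len, hv⟩) ++ acc) ∧
        t ≤ 300 * (n + 1) * (i.len + 1) := by
  induction i with
  | nil =>
    apply computes_of_wp neighborsCode rfl
    simp only [wp, neighborsCode, Code.snd, Data.tl_cons, Data.hd_cons]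
    refine ⟨fun _ => ⟨by simp [neighborBits, verticesBelow], ?_⟩, by simp⟩
    simp only [Data.len_nil]
    omega
  | cons x i _ ih =>
    apply computes_of_wp neighborsCode rfl
    simp only [wp, neighborsCode, Code.snd, Data.tl_cons, Data.hd_cons]
    simp only [Data.len_cons] at hi ⊢
    refine ⟨by simp, fun _ => wp_edgeCode hM hs ha _ _ _ _ hi hv fun t1 h1 =>
      wp_edgeCode hM hs ha _ _ _ _ hi hv fun t2 h2 => (ih (by omega)).mono ?_⟩
    rintro y t ⟨rfl, ht⟩
    have hl := verticesBelow_succ (⟨i.len, hi⟩ : Fin n)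
    simp only at hl
    refine ⟨?_, ?_⟩
    · rw [hd_encodeEntry, tl_encodeEntry, neighborBits, neighborBits, hl]
      simp
    · have : 300 * (n + 1) * (i.len + 1 + 1) = 300 * (n + 1) * (i.len + 1) + 300 * (n + 1) := by
        ring
      omega

/-- The bits for the removed vertices below `m`. -/
def ColoredGraph.blockBits (G : ColoredGraph (Fin n)) (S A : Finset (Fin n)) (m : ℕ) : List Bool :=
  typeBits (((verticesBelow n m).filter fun v => v ∉ S ∧ v ∉ A).map (G.colorsTo (A ∩ S)))

theorem computes_blocks (hM : IsMatrix G M) (hs : Represents s S) (ha : Represents a A)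
    (i : Data) (hi : i.len ≤ n) :
    Computes 6 (.cons i (.cons a (.cons M s))) fun y t =>
      y = encodeBits (G.blockBits S A i.len) ∧ t ≤ 400 * (n + 1) ^ 2 * (i.len + 1) := by
  have hpos := Nat.le_self_pow (two_ne_zero) (n + 1)
  induction i with
  | nil =>
    apply computes_of_wp blocksCode rfl
    simp only [wp, blocksCode, Code.snd, Data.tl_cons, Data.hd_cons]
    refine ⟨fun _ => ⟨by simp [ColoredGraph.blockBits, verticesBelow, typeBits], ?_⟩, by simp⟩
    simp only [Data.len_nil]
    omega
  | cons x i _ ih =>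
    apply computes_of_wp blocksCode rfl
    simp only [wp, blocksCode, Code.snd, Code.tail2, Code.tail3, Data.tl_cons, Data.hd_cons]
    simp only [Data.len_cons] at hi ⊢
    have hsi := hs ⟨i.len, hi⟩
    have hai := ha ⟨i.len, hi⟩
    simp only at hsi hai
    have hb : G.blockBits S A (i.len + 1) =
        (if (⟨i.len, hi⟩ : Fin n) ∉ S ∧ (⟨i.len, hi⟩ : Fin n) ∉ A then
          false :: neighborBits n (G.colorsTo (A ∩ S) ⟨i.len, hi⟩) else []) ++
          G.blockBits S A i.len := by
      have := verticesBelow_succ (⟨i.len, hi⟩ : Fin n)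
      simp only at this
      rw [ColoredGraph.blockBits, this, List.filter_cons]
      by_cases h : (⟨i.len, hi⟩ : Fin n) ∉ S ∧ (⟨i.len, hi⟩ : Fin n) ∉ A
      · simp [h, typeBits, ColoredGraph.blockBits]
      · simp only [h, decide_false, if_false, List.nil_append, Bool.false_eq_true]
        rfl
    have ht' : 400 * (n + 1) ^ 2 * (i.len + 1 + 1) =
        400 * (n + 1) ^ 2 * (i.len + 1) + 400 * (n + 1) ^ 2 := by ring
    refine ⟨by simp, fun _ => (computes_nth s i).mono ?_⟩
    rintro y t1 ⟨rfl, h1⟩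
    refine ⟨fun h => (computes_nth a i).mono ?_, fun h => (ih (by omega)).mono ?_⟩
    · rintro y t2 ⟨rfl, h2⟩
      refine ⟨fun h' => (ih (by omega)).mono ?_, fun h' => (ih (by omega)).mono ?_⟩
      · rintro y t3 ⟨rfl, h3⟩
        -- The matrix, a list of n rows, is passed as the unary number n.
        refine (computes_neighbors hM hs ha M i _ hM.len.le hi).mono ?_
        rintro y t4 ⟨rfl, h4⟩
        refine ⟨?_, ?_⟩
        · rw [hb, hM.len]
          simp [hsi.1 h, hai.1 h', encodeBool]
        · rw [hM.len, mul_assoc, ← sq] at h4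
          omega
      · rintro y t3 ⟨rfl, h3⟩
        exact ⟨by simp [hb, mt hai.2 h'], by omega⟩
    · rintro y t3 ⟨rfl, h3⟩
      exact ⟨by simp [hb, mt hsi.2 h], by omega⟩

theorem computes_members (hs : Represents s S) (ha : Represents a A) (i : Data) (acc : List Bool)
    (hi : i.len ≤ n) :
    Computes 7 (.cons i (.cons (encodeBits acc) (.cons a s))) fun y t =>
      y = encodeBits ((verticesBelow n i.len).map (fun v => decide (v ∈ A ∩ S)) ++ acc) ∧
        t ≤ 100 * (n + 1) * (i.len + 1) := by
  induction i with
  | nil =>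
    apply computes_of_wp membersCode rfl
    simp only [wp, membersCode, Code.snd, Data.tl_cons, Data.hd_cons]
    refine ⟨fun _ => ⟨by simp [verticesBelow], ?_⟩, by simp⟩
    simp only [Data.len_nil]
    omega
  | cons x i _ ih =>
    apply computes_of_wp membersCode rfl
    simp only [wp, membersCode, Code.snd, Code.one, Code.tail2, Code.tail3, Data.tl_cons,
      Data.hd_cons]
    simp only [Data.len_cons] at hi ⊢
    have hsi := hs ⟨i.len, hi⟩
    have hai := ha ⟨i.len, hi⟩
    have hl := verticesBelow_succ (⟨i.len, hi⟩ : Fin n)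
    simp only at hsi hai hl
    have ht' : 100 * (n + 1) * (i.len + 1 + 1) =
        100 * (n + 1) * (i.len + 1) + 100 * (n + 1) := by ring
    refine ⟨by simp, fun _ => (computes_nth s i).mono ?_⟩
    rintro y t1 ⟨rfl, h1⟩
    refine ⟨fun h => (ih (by omega)).mono ?_, fun h => (computes_nth a i).mono ?_⟩
    · rintro y t2 ⟨rfl, h2⟩
      exact ⟨by simp [hl, hsi.1 h, encodeBool], by omega⟩
    · have hS' := mt hsi.2 h
      rw [not_not] at hS'
      rintro y t2 ⟨rfl, h2⟩
      refine ⟨fun h' => (ih (by omega)).mono ?_, fun h' => (ih (by omega)).mono ?_⟩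
      · rintro y t3 ⟨rfl, h3⟩
        exact ⟨by simp [hl, hai.1 h', encodeBool], by omega⟩
      · have hA' := mt hai.2 h'
        rw [not_not] at hA'
        rintro y t3 ⟨rfl, h3⟩
        exact ⟨by simp [hl, hS', hA', encodeBool], by omega⟩

theorem computes_key (hM : IsMatrix G M) (hs : Represents s S) (ha : Represents a A) (p : Player) :
    Computes 8 (.cons (encodePlayer p) (.cons a (.cons M s))) fun y t =>
      y = encodeBits (G.bitKey S p A) ∧ t ≤ 600 * (n + 1) ^ 3 := by
  apply computes_of_wp keyCode rfl
  simp only [wp, keyCode, Code.snd, Code.tail2, Code.tail3, Data.tl_cons, Data.hd_cons]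
  refine (computes_blocks hM hs ha M hM.len.le).mono ?_
  rintro y t1 ⟨rfl, h1⟩
  refine (computes_members hs ha M _ hM.len.le).mono ?_
  rintro y t2 ⟨rfl, h2⟩
  rw [hM.len] at h1 h2 ⊢
  refine ⟨?_, ?_⟩
  · rw [encodePlayer_eq, ← encodeBits_cons]
    rfl
  · rw [mul_assoc, ← pow_succ, show 2 + 1 = 3 from rfl] at h1
    rw [mul_assoc, ← sq] at h2
    have h3 := Nat.pow_le_pow_right (Nat.succ_pos n) (show 2 ≤ 3 by norm_num)
    have h4 := Nat.le_self_pow three_ne_zero (n + 1)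
    simp only [Nat.succ_eq_add_one] at h3
    omega

end Keys

section Cover

variable {n : ℕ}

/-! ### The list of pairs -/

/-- The datum `d` is the pair of `u` and `v` together with the colour of the edge. -/
structure IsEntry (G : ColoredGraph (Fin n)) (d : Data) (u v : Fin n) : Prop where
  color : d.hd = encodeEntry (G.color u v)
  fst : d.tl.hd.len = u
  snd : d.tl.tl.len = v

theorem IsEntry.unique {G : ColoredGraph (Fin n)} {d : Data} {u v u' v' : Fin n}
    (h : IsEntry G d u v) (h' : IsEntry G d u' v') : u = u' ∧ v = v' :=
  ⟨Fin.ext (h.fst.symm.trans h'.fst), Fin.ext (h.snd.symm.trans h'.snd)⟩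

/-- The list contains all pairs of vertices. -/
structure IsPairList (G : ColoredGraph (Fin n)) (ds : List Data) : Prop where
  entry : ∀ d ∈ ds, ∃ u v, IsEntry G d u v
  complete : ∀ u v, ∃ d ∈ ds, IsEntry G d u v
  length : ds.length ≤ n * n

variable {G : ColoredGraph (Fin n)} {M : Data}

theorem computes_row (hM : IsMatrix G M) (i u : Data) (acc : List Data) (hi : i.len ≤ n)
    (hu : u.len < n) :
    Computes 19 (.cons i (.cons (encodeList acc) (.cons u M))) fun y t =>
      ∃ ds : List Data, y = encodeList (ds ++ acc) ∧ ds.length = i.len ∧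
        (∀ d ∈ ds, ∃ v, IsEntry G d ⟨u.len, hu⟩ v) ∧
        (∀ v : Fin n, (v : ℕ) < i.len → ∃ d ∈ ds, IsEntry G d ⟨u.len, hu⟩ v) ∧
        t ≤ 100 * (n + 1) * (i.len + 1) := by
  induction i with
  | nil =>
    apply computes_of_wp rowCode rfl
    simp only [wp, rowCode, Code.snd, Data.tl_cons, Data.hd_cons]
    refine ⟨fun _ => ⟨[], by simp, rfl, by simp, by simp, ?_⟩, by simp⟩
    simp only [Data.len_nil]
    omega
  | cons x i _ ih =>
    apply computes_of_wp rowCode rfl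
    simp only [wp, rowCode, Code.snd, Code.tail2, Code.tail3, Data.tl_cons, Data.hd_cons]
    simp only [Data.len_cons] at hi ⊢
    refine ⟨by simp, fun _ => (computes_nth M u).mono ?_⟩
    rintro y t1 ⟨rfl, h1⟩
    refine (computes_nth _ i).mono ?_
    rintro y t2 ⟨rfl, h2⟩
    refine (ih (by omega)).mono ?_
    rintro y t ⟨ds, rfl, hlen, hd, hc, ht⟩
    have he : IsEntry G (.cons ((M.nth u.len).nth i.len) (.cons u i)) ⟨u.len, hu⟩ ⟨i.len, hi⟩ :=
      ⟨hM.nth ⟨u.len, hu⟩ ⟨i.len, hi⟩, rfl, rfl⟩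
    refine ⟨_ :: ds, rfl, by simp [hlen], ?_, ?_, ?_⟩
    · intro d hd'
      rcases List.mem_cons.1 hd' with rfl | hd'
      · exact ⟨_, he⟩
      · exact hd d hd'
    · intro v hv
      rcases Nat.lt_succ_iff_lt_or_eq.1 hv with hv | hv
      · obtain ⟨d, hd', h⟩ := hc v hv
        exact ⟨d, List.mem_cons_of_mem _ hd', h⟩
      · obtain rfl : v = ⟨i.len, hi⟩ := Fin.ext hv
        exact ⟨_, List.mem_cons_self, he⟩
    · have : 100 * (n + 1) * (i.len + 1 + 1) = 100 * (n + 1) * (i.len + 1) + 100 * (n + 1) := by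
        ring
      omega

theorem computes_rows (hM : IsMatrix G M) (i : Data) (hi : i.len ≤ n) :
    Computes 20 (.cons i M) fun y t =>
      ∃ ds : List Data, y = encodeList ds ∧ ds.length ≤ i.len * n ∧
        (∀ d ∈ ds, ∃ u v, IsEntry G d u v) ∧
        (∀ u v : Fin n, (u : ℕ) < i.len → ∃ d ∈ ds, IsEntry G d u v) ∧
        t ≤ 200 * (n + 1) ^ 2 * (i.len + 1) := by
  have hpos := Nat.le_self_pow (two_ne_zero) (n + 1)
  induction i with
  | nil =>
    apply computes_of_wp rowsCode rfl
    simp only [wp, rowsCode, Data.hd_cons]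
    refine ⟨fun _ => ⟨[], rfl, by simp, by simp, by simp, ?_⟩, by simp⟩
    simp only [Data.len_nil]
    omega
  | cons x i _ ih =>
    apply computes_of_wp rowsCode rfl
    simp only [wp, rowsCode, Data.tl_cons, Data.hd_cons]
    simp only [Data.len_cons] at hi ⊢
    refine ⟨by simp, fun _ => (ih (by omega)).mono ?_⟩
    rintro y t1 ⟨ds, rfl, hlen, hd, hc, h1⟩
    refine (computes_row hM M i ds hM.len.le hi).mono ?_
    rintro y t2 ⟨ds', rfl, hlen', hd', hc', h2⟩
    refine ⟨ds' ++ ds, rfl, ?_, ?_, ?_, ?_⟩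
    · rw [List.length_append, hlen', hM.len]
      linarith
    · intro d h
      rcases List.mem_append.1 h with h | h
      · exact ⟨_, hd' d h⟩
      · exact hd d h
    · intro u v hu
      rcases Nat.lt_succ_iff_lt_or_eq.1 hu with hu | hu
      · obtain ⟨d, h, h'⟩ := hc u v hu
        exact ⟨d, List.mem_append_right _ h, h'⟩
      · obtain rfl : u = ⟨i.len, hi⟩ := Fin.ext hu
        obtain ⟨d, h, h'⟩ := hc' v (by rw [hM.len]; exact v.2)
        exact ⟨d, List.mem_append_left _ h, h'⟩
    · rw [hM.len, mul_assoc, ← sq] at h2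
      have : 200 * (n + 1) ^ 2 * (i.len + 1 + 1) =
        200 * (n + 1) ^ 2 * (i.len + 1) + 200 * (n + 1) ^ 2 := by ring
      omega

theorem computes_pairs (hM : IsMatrix G M) :
    Computes 20 (.cons M M) fun y t =>
      ∃ ds : List Data, y = encodeList ds ∧ IsPairList G ds ∧ t ≤ 200 * (n + 1) ^ 3 := by
  refine (computes_rows hM M hM.len.le).mono ?_
  rintro y t ⟨ds, rfl, hlen, hd, hc, ht⟩
  rw [hM.len] at *
  refine ⟨ds, rfl, ⟨hd, fun u v => hc u v u.2, hlen⟩, ?_⟩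
  rwa [mul_assoc, ← pow_succ] at ht

/-! ### Vertex covers -/

variable (G) in
/-- The set `C` contains an endpoint of each edge in the list. -/
def Covers (ds : List Data) (C : Finset (Fin n)) : Prop :=
  ∀ d ∈ ds, ∀ u v, IsEntry G d u v → G.color u v ≠ none → u ∈ C ∨ v ∈ C

theorem IsPairList.covers_iff {ds : List Data} (h : IsPairList G ds) {C : Finset (Fin n)} :
    Covers G ds C ↔ G.graph.IsVertexCover (C : Set (Fin n)) := by
  constructor
  · intro hC u v huv
    obtain ⟨d, hd, he⟩ := h.complete u v
    exact hC d hd u v he huv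
  · intro hC d _ u v _ huv
    exact hC huv

theorem covers_cons {d : Data} {ds : List Data} {C : Finset (Fin n)} {u v : Fin n}
    (h : IsEntry G d u v) :
    Covers G (d :: ds) C ↔ (G.color u v ≠ none → u ∈ C ∨ v ∈ C) ∧ Covers G ds C := by
  constructor
  · intro hC
    exact ⟨hC d List.mem_cons_self u v h, fun d' hd' => hC d' (List.mem_cons_of_mem _ hd')⟩
  · rintro ⟨h1, h2⟩ d' hd' u' v' he
    rcases List.mem_cons.1 hd' with rfl | hd'
    · obtain ⟨rfl, rfl⟩ := h.unique he
      exact h1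
    · exact h2 d' hd' u' v' he

variable (G) in
/-- `y` is a set that covers the edges in the list and contains `S` and at most `k` further
vertices, or `nil` if there is none. -/
def IsCoverResult (ds : List Data) (S : Finset (Fin n)) (k : ℕ) (y : Data) : Prop :=
  (y = .nil ∧ ∀ C, S ⊆ C → Covers G ds C → S.card + k < C.card) ∨
    ∃ s C, y = .cons s .nil ∧ Represents s C ∧ S ⊆ C ∧ Covers G ds C ∧ C.card ≤ S.card + k

theorem IsCoverResult.cons {d : Data} {ds : List Data} {S : Finset (Fin n)} {k : ℕ} {y : Data}
    {u v : Fin n} (he : IsEntry G d u v) (hS : G.color u v ≠ none → u ∈ S ∨ v ∈ S)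
    (h : IsCoverResult G ds S k y) : IsCoverResult G (d :: ds) S k y := by
  rcases h with ⟨rfl, h⟩ | ⟨s, C, rfl, hs, hSC, hC, hk⟩
  · exact .inl ⟨rfl, fun C hSC hC => h C hSC ((covers_cons he).1 hC).2⟩
  · exact .inr ⟨s, C, rfl, hs, hSC, (covers_cons he).2
      ⟨fun hc => (hS hc).imp (fun h => hSC h) (fun h => hSC h), hC⟩, hk⟩

/-- Bounded search tree: an uncovered edge forces one of its endpoints into the cover, and either
choice uses up one of the k permitted vertices. This gives the factor 2^k. -/
theorem computes_cover (ds : List Data) (hds : ∀ d ∈ ds, ∃ u v, IsEntry G d u v) (s k : Data)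
    {S : Finset (Fin n)} (hs : Represents s S) :
    Computes 15 (.cons (encodeList ds) (.cons s k)) fun y t =>
      IsCoverResult G ds S k.len y ∧ t ≤ 300 * (n + 1) * (ds.length + 1) * 2 ^ k.len := by
  induction ds generalizing s k S with
  | nil =>
    apply computes_of_wp coverCode rfl
    simp only [wp, coverCode, Code.snd, Data.tl_cons, Data.hd_cons, encodeList]
    refine ⟨fun _ => ⟨.inr ⟨s, S, rfl, hs, subset_rfl, by simp [Covers], by simp⟩, ?_⟩, by simp⟩
    have := Nat.one_le_two_pow (n := k.len)
    simp only [List.length_nil]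
    nlinarith
  | cons d ds ih =>
    obtain ⟨u, v, he⟩ := hds d List.mem_cons_self
    replace ih := fun s k S hs => @ih (fun d hd => hds d (List.mem_cons_of_mem _ hd)) s k S hs
    apply computes_of_wp coverCode rfl
    simp only [wp, coverCode, Code.snd, Code.one, Code.tail2, Code.tail3, Data.tl_cons,
      Data.hd_cons, encodeList, List.length_cons]
    have hmul : 300 * (n + 1) * (ds.length + 1 + 1) * 2 ^ k.len =
        300 * (n + 1) * (ds.length + 1) * 2 ^ k.len + 300 * (n + 1) * 2 ^ k.len := by ring
    have hpos : 300 * (n + 1) ≤ 300 * (n + 1) * 2 ^ k.len :=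
      Nat.le_mul_of_pos_right _ Nat.one_le_two_pow
    have hcolor : d.hd ≠ .nil ↔ G.color u v ≠ none := by
      rw [he.color]
      rcases G.color u v with _ | _ | _ | _ <;> simp [encodeEntry]
    have hsu := hs u
    have hsv := hs v
    have hu := u.2
    have hv := v.2
    refine ⟨by simp, fun _ => ⟨fun hc => (ih s k S hs).mono ?_, fun hc =>
      (computes_nth s _).mono ?_⟩⟩
    · rintro y t ⟨hy, ht⟩
      exact ⟨hy.cons he fun h => absurd hc (hcolor.2 h), by omega⟩
    rintro y t1 ⟨rfl, h1⟩
    rw [he.fst] at h1 ⊢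
    refine ⟨fun hu' => (computes_nth s _).mono ?_, fun hu' => (ih s k S hs).mono ?_⟩
    swap
    · rintro y t ⟨hy, ht⟩
      exact ⟨hy.cons he fun _ => .inl (not_not.1 (mt hsu.2 hu')), by omega⟩
    rintro y t2 ⟨rfl, h2⟩
    rw [he.snd] at h2 ⊢
    refine ⟨fun hv' => ?_, fun hv' => (ih s k S hs).mono ?_⟩
    swap
    · rintro y t ⟨hy, ht⟩
      exact ⟨hy.cons he fun _ => .inr (not_not.1 (mt hsv.2 hv')), by omega⟩
    rw [hsu] at hu'
    rw [hsv] at hv'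
    have hnone : ∀ C, Covers G (d :: ds) C → (u ∈ C ∨ v ∈ C) ∧ Covers G ds C := fun C hC =>
      ((covers_cons he).1 hC).imp_left fun h => h (hcolor.1 hc)
    cases k with
    | nil =>
      -- With no vertex left to add, any cover containing S is strictly larger than S, as S misses
      -- this edge.
      refine ⟨fun _ => ⟨.inl ⟨rfl, fun C hSC hC => ?_⟩, by omega⟩, by simp⟩
      rw [Data.len_nil, add_zero]
      refine Finset.card_lt_card (hSC.ssubset_of_ne ?_)
      rintro rfl
      exact (hnone _ hC).1.elim hu' hv'
    | cons x k =>
      have hins : ∀ w, w ∉ S → (w = u ∨ w = v) → ∀ y, IsCoverResult G ds (insert w S) k.len y →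
          y ≠ .nil → IsCoverResult G (d :: ds) S (k.len + 1) y := by
        rintro w hwS hw y (⟨rfl, -⟩ | ⟨s, C, rfl, hs, hSC, hC, hk⟩) hy
        · exact absurd rfl hy
        · rw [Finset.card_insert_of_notMem hwS] at hk
          have hwC := hSC (Finset.mem_insert_self w S)
          refine .inr ⟨s, C, rfl, hs, (Finset.subset_insert _ _).trans hSC,
            (covers_cons he).2 ⟨fun _ => ?_, hC⟩, by omega⟩
          rcases hw with rfl | rfl
          exacts [.inl hwC, .inr hwC]
      refine ⟨by simp, fun _ => (computes_upd s _ _).mono ?_⟩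
      rw [he.fst]
      rintro y t3 ⟨rfl, h3⟩
      refine (ih _ k _ (hs.upd_cons u _ _)).mono ?_
      rintro y1 t4 ⟨hy1, h4⟩
      refine (computes_upd s _ _).mono ?_
      rw [he.snd]
      rintro y t5 ⟨rfl, h5⟩
      apply computes_of_wp coverOrCode rfl
      simp only [wp, coverOrCode, Data.tl_cons, Data.hd_cons, Data.len_cons]
      have hdouble : 300 * (n + 1) * (ds.length + 1) * 2 ^ (k.len + 1) =
        300 * (n + 1) * (ds.length + 1) * 2 ^ k.len +
          300 * (n + 1) * (ds.length + 1) * 2 ^ k.len := by ring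
      simp only [Data.len_cons] at hmul hpos
      refine ⟨fun h => (ih _ k _ (hs.upd_cons v _ _)).mono ?_, fun h =>
        ⟨hins u hu' (.inl rfl) y1 hy1 h, by omega⟩⟩
      rintro y2 t6 ⟨hy2, h6⟩
      refine ⟨?_, by omega⟩
      by_cases hy : y2 = .nil
      · refine .inl ⟨hy, fun C hSC hC => ?_⟩
        have h1 : ∀ w, w ∉ S → ∀ y, y = .nil → IsCoverResult G ds (insert w S) k.len y → w ∈ C →
            S.card + (k.len + 1) < C.card := by
          rintro w hwS y rfl (⟨-, h⟩ | ⟨s, C, h, -⟩) hw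
          · have := h C (Finset.insert_subset hw hSC) (hnone C hC).2
            rw [Finset.card_insert_of_notMem hwS] at this
            omega
          · simp at h
        rcases (hnone C hC).1 with hw | hw
        · exact h1 u hu' y1 h hy1 hw
        · exact h1 v hv' y2 hy hy2 hw
      · exact hins v hv' (.inr rfl) y2 hy2 hy

/-- The budget k is raised one by one, and j counts the increases still possible. At k = τ the
search cannot fail because of C. -/
theorem computes_find {ds : List Data} (hds : ∀ d ∈ ds, ∃ u v, IsEntry G d u v) {τ : ℕ}
    {C : Finset (Fin n)} (hC : Covers G ds C) (hτ : C.card ≤ τ) (j : ℕ) (k : Data)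
    (hk : k.len + j = τ) :
    Computes 17 (.cons (encodeList ds) k) fun y t =>
      (∃ S, Represents y S ∧ Covers G ds S ∧ S.card ≤ τ) ∧
        t ≤ (300 * (n + 1) * (ds.length + 1) * 2 ^ τ + 100) * (j + 1) := by
  have hempty : Represents Data.nil (∅ : Finset (Fin n)) := fun i => by simp
  induction j generalizing k with
  | zero =>
    apply computes_of_wp findCode rfl
    simp only [wp, findCode, Data.tl_cons, Data.hd_cons]
    refine (computes_cover ds hds _ k hempty).mono ?_
    rintro y t1 ⟨hy | ⟨s, S, rfl, hs, -, hS, hcard⟩, h1⟩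
    · have := hy.2 C (by simp) hC
      simp at this
      omega
    apply computes_of_wp findNextCode rfl
    simp only [wp, findNextCode, Data.hd_cons]
    refine ⟨by simp, fun _ => ⟨⟨S, hs, hS, by simpa [← hk] using hcard⟩, ?_⟩⟩
    rw [add_zero] at hk
    rw [hk] at h1
    omega
  | succ j ih =>
    apply computes_of_wp findCode rfl
    simp only [wp, findCode, Data.tl_cons, Data.hd_cons]
    refine (computes_cover ds hds _ k hempty).mono ?_
    rintro y t1 ⟨hy, h1⟩
    have h2 : 300 * (n + 1) * (ds.length + 1) * 2 ^ k.len ≤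
        300 * (n + 1) * (ds.length + 1) * 2 ^ τ :=
      Nat.mul_le_mul_left _ (Nat.pow_le_pow_right (by norm_num) (by omega))
    have h3 : (300 * (n + 1) * (ds.length + 1) * 2 ^ τ + 100) * (j + 1 + 1) =
      (300 * (n + 1) * (ds.length + 1) * 2 ^ τ + 100) * (j + 1) +
        300 * (n + 1) * (ds.length + 1) * 2 ^ τ + 100 := by ring
    apply computes_of_wp findNextCode rfl
    simp only [wp, findNextCode, Code.snd, Code.tail2, Data.tl_cons, Data.hd_cons]
    rcases hy with ⟨rfl, -⟩ | ⟨s, S, rfl, hs, -, hS, hcard⟩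
    · refine ⟨fun _ => (ih (.cons .nil k) (by simp only [Data.len_cons]; omega)).mono ?_, by simp⟩
      rintro y t ⟨hy, ht⟩
      exact ⟨hy, by omega⟩
    · refine ⟨by simp, fun _ => ⟨⟨S, hs, hS, hcard.trans ?_⟩, ?_⟩⟩
      · rw [Finset.card_empty]
        omega
      · omega

end Cover

/-! ### The memoized search -/

section Search

open ColoredGraph (IsBalanced)

variable {n : ℕ} {G : ColoredGraph (Fin n)} {M s : Data} {S : Finset (Fin n)}

theorem isMove_iff_selects {p : Player} {A : Finset (Fin n)} {u v : Fin n} :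
    G.IsMove p A u v ↔ u ∈ A ∧ v ∈ A ∧ p.selects (G.color u v) = true := by
  rw [ColoredGraph.IsMove, Player.selects_iff]

theorem wp_selectsCode {p : Player} {d : Data} {u v : Fin n} (he : IsEntry G d u v) (L m x : Data)
    {Q : Data → ℕ → Prop} (hQ : ∀ t ≤ 30, Q (encodeBool (p.selects (G.color u v))) t) :
    wp (.cons (.cons d L) (.cons m (.cons (encodePlayer p) x))) selectsCode Q := by
  simp only [wp, selectsCode, Code.tail2, Data.tl_cons, Data.hd_cons, he.color, hd_encodeEntry,
    tl_encodeEntry]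
  cases p
  · exact ⟨by simp [encodePlayer], fun _ => hQ _ (by omega)⟩
  · exact ⟨fun _ => hQ _ (by omega), by simp [encodePlayer]⟩

theorem wp_otherCode {p : Player} (L m x : Data) {Q : Data → ℕ → Prop}
    (hQ : ∀ t ≤ 30, Q (encodePlayer p.other) t) :
    wp (.cons L (.cons m (.cons (encodePlayer p) x))) otherCode Q := by
  simp only [wp, otherCode, Code.tail2, Code.one, Data.tl_cons, Data.hd_cons]
  cases p
  · exact ⟨by simp [encodePlayer], fun _ => hQ _ (by omega)⟩
  · exact ⟨fun _ => hQ _ (by omega), by simp [encodePlayer]⟩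

theorem wp_moveCode {p : Player} {A : Finset (Fin n)} {a d : Data} {u v : Fin n}
    (ha : Represents a A) (he : IsEntry G d u v) (L m x : Data) {Q : Data → ℕ → Prop}
    (hQ : ∀ y t, (y = .nil ↔ ¬ G.IsMove p A u v) → t ≤ 100 * (n + 1) → Q y t) :
    wp (.cons (.cons d L) (.cons m (.cons (encodePlayer p) (.cons a x)))) moveCode Q := by
  have hau := ha u
  have hav := ha v
  have hu := u.2
  have hv := v.2
  simp only [isMove_iff_selects] at hQ
  simp only [wp, moveCode, Code.snd, Code.tail2, Data.tl_cons, Data.hd_cons]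
  refine wp_selectsCode he _ _ _ fun t ht => ?_
  simp only [ne_eq, encodeBool_eq_nil]
  refine ⟨fun h => hQ _ _ (by simp [h]) (by omega), fun h => (computes_nth a _).mono ?_⟩
  rw [he.fst]
  rintro y t1 ⟨rfl, h1⟩
  refine ⟨fun h' => hQ _ _ (by simp [hau.1 h']) (by omega), fun h' => (computes_nth a _).mono ?_⟩
  rw [he.snd]
  rintro y t2 ⟨rfl, h2⟩
  rw [hau, not_not] at h'
  exact hQ _ _ (by simp [hav, h', h]) (by omega)

/-! ### The memo and its load -/

variable (G) in
open Classical in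
/-- The memoized value of a position. -/
noncomputable def memoValue (p : Player) (A : Finset (Fin n)) : Data :=
  .cons (encodeBool (decide (G.Wins p A))) .nil

variable (G S) in
/-- All values in the memo are correct. -/
def IsMemo (m : Data) : Prop :=
  ∀ k, m.get k ≠ .nil → ∃ p A, IsBalanced S A ∧ k = G.bitKey S p A ∧ m.get k = memoValue G p A

variable (G S) in
/-- The keys of all balanced positions. -/
noncomputable def allKeys : Finset (List Bool) :=
  (({.black, .white} : Finset Player) ×ˢ G.keys (verticesBelow n n) S).image
    fun x => keyBits x.1 x.2

theorem bitKey_mem_allKeys (p : Player) {A : Finset (Fin n)} (hA : IsBalanced S A) :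
    G.bitKey S p A ∈ allKeys G S :=
  Finset.mem_image.2 ⟨(p, _), Finset.mem_product.2 ⟨by cases p <;> simp, G.mem_keys _ hA⟩, rfl⟩

theorem card_allKeys_le :
    (allKeys G S).card ≤ 2 * ((G.numColors + 1) ^ (S.card ^ 2 / 4) * 3 ^ S.card) := by
  refine Finset.card_image_le.trans ?_
  rw [Finset.card_product]
  exact Nat.mul_le_mul (by simp) (G.card_keys_le (nodup_verticesBelow n n) S)

variable (G S) in
open Classical in
/-- The number of positions in the memo. -/
noncomputable def load (m : Data) : ℕ := ((allKeys G S).filter fun k => m.get k ≠ .nil).card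

theorem load_le (m : Data) : load G S m ≤ (allKeys G S).card := by
  classical exact Finset.card_filter_le _ _

theorem load_put {m v : Data} {k : List Bool} (hk : k ∈ allKeys G S) (hm : m.get k = .nil)
    (hv : v ≠ .nil) : load G S (m.put v k) = load G S m + 1 := by
  classical
  unfold load
  rw [← Finset.card_insert_of_notMem (a := k) (by simp [hm])]
  congr 1
  ext k'
  by_cases h : k' = k
  · simp [h, hk, Data.get_put, hv]
  · simp [h, Data.get_put]

theorem IsMemo.put {m : Data} (hm : IsMemo G S m) (p : Player) {A : Finset (Fin n)}
    (hA : IsBalanced S A) : IsMemo G S (m.put (memoValue G p A) (G.bitKey S p A)) := by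
  intro k hk
  rw [Data.get_put] at hk ⊢
  by_cases h : k = G.bitKey S p A
  · exact ⟨p, A, hA, h, by simp [h]⟩
  · rw [if_neg h] at hk ⊢
    exact hm k hk

/-- The entry may have been stored for another position B, but equal keys give the same player and
isomorphic positions, hence the same winner. -/
theorem IsMemo.get_eq (hS : G.graph.IsVertexCover (S : Set (Fin n))) {m : Data}
    (hm : IsMemo G S m) (p : Player) (A : Finset (Fin n)) (h : m.get (G.bitKey S p A) ≠ .nil) :
    m.get (G.bitKey S p A) = memoValue G p A := by
  classical
  obtain ⟨q, B, -, hk, hv⟩ := hm _ h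
  obtain ⟨rfl, hAB⟩ := ColoredGraph.samePosition_of_bitKey_eq hS hk
  rw [hv, memoValue, memoValue, decide_eq_decide.2 (hAB.wins_iff p)]

variable (G M s S) in
/-- The function `solve` works for the position with time amortized over new entries of the memo. -/
def Solves (E : Data) (p : Player) (A : Finset (Fin n)) : Prop :=
  ∀ m a, Represents a A → IsMemo G S m →
    Computes 9 (.cons m (.cons (encodePlayer p) (.cons a (.cons E (.cons M s))))) fun y t =>
      ∃ m', y = .cons (memoValue G p A) m' ∧ IsMemo G S m' ∧
        (∀ k, m'.get k ≠ .nil → m.get k ≠ .nil ∨ ∃ q B, B ⊆ A ∧ k = G.bitKey S q B) ∧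
        t + 3000 * (n + 1) ^ 5 * load G S m ≤
          1200 * (n + 1) ^ 3 + 3000 * (n + 1) ^ 5 * load G S m'

/-- The load acts as a potential: beyond what new entries pay for, each pair costs a fixed
polynomial amount. New keys come from proper subpositions of A only. -/
theorem computes_loop (hS : G.graph.IsVertexCover (S : Set (Fin n))) {E : Data} {p : Player}
    {A : Finset (Fin n)} {a : Data} (ha : Represents a A) (hA : IsBalanced S A)
    (ih : ∀ B ⊂ A, IsBalanced S B → Solves G M s S E p.other B) (ds : List Data)
    (hds : ∀ d ∈ ds, ∃ u v, IsEntry G d u v) (m : Data) (hm : IsMemo G S m) :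
    Computes 13 (.cons (encodeList ds) (.cons m
      (.cons (encodePlayer p) (.cons a (.cons E (.cons M s)))))) fun y t =>
      ∃ b m', y = .cons (encodeBool b) m' ∧
        (b = true ↔ ∃ d ∈ ds, ∃ u v, IsEntry G d u v ∧ G.IsMove p A u v ∧
          ¬ G.Wins p.other (A \ {u, v})) ∧ IsMemo G S m' ∧
        (∀ k, m'.get k ≠ .nil → m.get k ≠ .nil ∨ ∃ q B, B ⊂ A ∧ k = G.bitKey S q B) ∧
        t + 3000 * (n + 1) ^ 5 * load G S m ≤
          1500 * (n + 1) ^ 3 * (ds.length + 1) + 3000 * (n + 1) ^ 5 * load G S m' := by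
  have hpos := Nat.le_self_pow three_ne_zero (n + 1)
  induction ds generalizing m with
  | nil =>
    apply computes_of_wp loopCode rfl
    simp only [wp, loopCode, Code.snd, Data.tl_cons, Data.hd_cons, encodeList]
    refine ⟨fun _ => ⟨false, m, rfl, by simp, hm, fun k hk => .inl hk, ?_⟩, by simp⟩
    simp only [List.length_nil]
    omega
  | cons d ds ihd =>
    obtain ⟨u, v, he⟩ := hds d List.mem_cons_self
    replace ihd := fun m hm => ihd (fun d hd => hds d (List.mem_cons_of_mem _ hd)) m hm
    have hmul : 1500 * (n + 1) ^ 3 * (ds.length + 1 + 1) =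
        1500 * (n + 1) ^ 3 * (ds.length + 1) + 1500 * (n + 1) ^ 3 := by ring
    have hex : (∃ d' ∈ d :: ds, ∃ u v, IsEntry G d' u v ∧ G.IsMove p A u v ∧
        ¬ G.Wins p.other (A \ {u, v})) ↔
        (G.IsMove p A u v ∧ ¬ G.Wins p.other (A \ {u, v})) ∨
          ∃ d ∈ ds, ∃ u v, IsEntry G d u v ∧ G.IsMove p A u v ∧
            ¬ G.Wins p.other (A \ {u, v}) := by
      rw [List.exists_mem_cons_iff]
      refine or_congr_left ⟨?_, fun h => ⟨u, v, he, h⟩⟩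
      rintro ⟨u', v', he', h⟩
      obtain ⟨rfl, rfl⟩ := he.unique he'
      exact h
    simp only [hex, List.length_cons]
    apply computes_of_wp loopCode rfl
    simp only [wp, loopCode, Code.snd, Code.tail2, Code.tail4, Data.tl_cons, Data.hd_cons,
      encodeList]
    refine ⟨by simp, fun _ => wp_moveCode ha he _ _ _ fun y t0 hy h0 =>
      ⟨fun h => (ihd m hm).mono ?_, fun h => wp_otherCode _ _ _ fun t1 h1 => ?_⟩⟩
    · rintro y t ⟨b, m', rfl, hb, hm', hk, ht⟩
      refine ⟨b, m', rfl, ?_, hm', hk, by omega⟩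
      simp only [hb, hy.1 h, false_and, false_or]
    have hmove : G.IsMove p A u v := not_not.1 (mt hy.2 h)
    have hu := u.2
    have hv := v.2
    refine (computes_upd a _ _).mono ?_
    rw [he.fst]
    rintro y t2 ⟨rfl, h2⟩
    refine (computes_upd _ _ _).mono ?_
    rw [he.snd]
    rintro y t3 ⟨rfl, h3⟩
    have ha' : Represents ((a.upd .nil u).upd .nil v) (A \ {u, v}) := by
      have := (ha.upd_nil u).upd_nil v
      rwa [← Finset.sdiff_singleton_eq_erase, ← Finset.sdiff_singleton_eq_erase,
        Finset.sdiff_sdiff_left', ← Finset.sdiff_union_distrib] at this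
    refine (ih _ hmove.sdiff_ssubset (hA.move hS hmove) m _ ha' hm).mono ?_
    rintro y t4 ⟨m1, rfl, hm1, hk1, h4⟩
    apply computes_of_wp loopNextCode rfl
    simp only [wp, loopNextCode, Code.snd, Code.one, Code.tail2, Code.tail3, Data.tl_cons,
      Data.hd_cons, memoValue, encodeBool_eq_nil]
    refine ⟨fun h => ?_, fun h => (ihd m1 hm1).mono ?_⟩
    · simp only [decide_eq_false_iff_not] at h
      refine ⟨true, m1, rfl, by simp [hmove, h], hm1, fun k hk => (hk1 k hk).imp_right ?_, ?_⟩
      · rintro ⟨q, B, hB, rfl⟩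
        exact ⟨q, B, hB.trans_ssubset hmove.sdiff_ssubset, rfl⟩
      · omega
    · simp only [ne_eq, encodeBool_eq_nil, decide_eq_false_iff_not, not_not] at h
      rintro y t ⟨b, m', rfl, hb, hm', hk, ht⟩
      refine ⟨b, m', rfl, by simp [hb, h], hm', fun k hk' => ?_, ?_⟩
      · rcases hk k hk' with hk | hk
        · refine (hk1 k hk).imp_right ?_
          rintro ⟨q, B, hB, rfl⟩
          exact ⟨q, B, hB.trans_ssubset hmove.sdiff_ssubset, rfl⟩
        · exact .inr hk
      · omega

/-- On a hit the time is that of computing and looking up the key. On a miss the loop over at most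
n² pairs is charged to the entry stored for A. -/
theorem solves (hM : IsMatrix G M) (hs : Represents s S)
    (hS : G.graph.IsVertexCover (S : Set (Fin n))) {ds : List Data} (hds : IsPairList G ds)
    (p : Player) (A : Finset (Fin n)) (hA : IsBalanced S A) :
    Solves G M s S (encodeList ds) p A := by
  induction A using Finset.strongInduction generalizing p with
  | H A ih =>
    intro m a ha hm
    apply computes_of_wp solveCode rfl
    simp only [wp, solveCode, Code.snd, Code.tail2, Code.tail4, Data.tl_cons, Data.hd_cons]
    refine (computes_key hM hs ha p).mono ?_
    rintro y t1 ⟨rfl, h1⟩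
    apply computes_of_wp solveKeyCode rfl
    simp only [wp, solveKeyCode, Code.snd, Data.tl_cons, Data.hd_cons]
    refine (computes_get m _).mono ?_
    rintro y t2 ⟨rfl, h2⟩
    have hlen := G.length_bitKey_le S p A
    have hpow : (n + 1) ^ 2 ≤ (n + 1) ^ 3 := Nat.pow_le_pow_right (by omega) (by norm_num)
    have hpow' : (n + 1) ^ 3 ≤ (n + 1) ^ 5 := Nat.pow_le_pow_right (by omega) (by norm_num)
    have hpos := Nat.le_self_pow two_ne_zero (n + 1)
    apply computes_of_wp solveMemoCode rfl
    simp only [wp, solveMemoCode, Code.snd, Code.tail2, Code.tail4, Data.tl_cons, Data.hd_cons]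
    refine ⟨fun h => ?_, fun h => ?_⟩
    swap
    · exact ⟨m, by rw [hm.get_eq hS p A h], hm, fun k hk => .inl hk, by omega⟩
    refine (computes_loop hS ha hA (fun B hB hB' => ih B hB _ hB') ds hds.entry m hm).mono ?_
    rintro y t3 ⟨b, m1, rfl, hb, hm1, hk1, h3⟩
    have hb' : b = true ↔ G.Wins p A := by
      rw [hb, G.wins_iff]
      constructor
      · rintro ⟨d, -, u, v, -, h⟩
        exact ⟨u, v, h⟩
      · rintro ⟨u, v, h⟩
        obtain ⟨d, hd, he⟩ := hds.complete u v
        exact ⟨d, hd, u, v, he, h⟩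
    have hval : Data.cons (encodeBool b) .nil = memoValue G p A := by
      rw [memoValue]
      by_cases hw : G.Wins p A <;> simp [hw] <;> simp_all
    apply computes_of_wp storeCode rfl
    simp only [wp, storeCode, Code.snd, Code.tail2, Data.tl_cons, Data.hd_cons]
    refine (computes_put m1 _ _).mono ?_
    rintro y t4 ⟨rfl, h4⟩
    rw [hval]
    -- The loop cannot have stored this key: its new keys belong to smaller positions, while equal
    -- keys force equal cardinality. So storing raises the load by one.
    have hnil : m1.get (G.bitKey S p A) = .nil := by
      by_contra hne
      rcases hk1 _ hne with hne | ⟨q, B, hB, hk⟩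
      · exact hne h
      · have := (ColoredGraph.samePosition_of_bitKey_eq hS hk).2.card_eq
        exact absurd this (Finset.card_lt_card hB).ne'
    refine ⟨_, rfl, hm1.put p hA, fun k hk => ?_, ?_⟩
    · rw [Data.get_put] at hk
      by_cases hkA : k = G.bitKey S p A
      · exact .inr ⟨p, A, subset_rfl, hkA⟩
      · rw [if_neg hkA] at hk
        refine (hk1 k hk).imp_right ?_
        rintro ⟨q, B, hB, h⟩
        exact ⟨q, B, hB.subset, h⟩
    · rw [load_put (bitKey_mem_allKeys p hA) hnil (by simp [memoValue])]
      -- The loop uses half of the credit 3000 (n + 1)^5 of the new entry; the rest covers looking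
      -- up and storing.
      have h5 : 1500 * (n + 1) ^ 3 * (ds.length + 1) ≤ 1500 * (n + 1) ^ 5 := by
        have := hds.length
        calc 1500 * (n + 1) ^ 3 * (ds.length + 1) ≤ 1500 * (n + 1) ^ 3 * (n + 1) ^ 2 := by
              gcongr
              nlinarith
          _ = _ := by ring
      rw [mul_add, mul_one]
      generalize 3000 * (n + 1) ^ 5 * load G S m = X at *
      generalize 3000 * (n + 1) ^ 5 * load G S m1 = Y at *
      omega

end Search

/-! ### Running times -/

theorem computes_main {n : ℕ} (G : ColoredGraph (Fin n)) (p : Player) {τ : ℕ}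
    (hτ : G.graph.vertexCoverNum = τ) :
    Computes 0 (encodeInstance G p) fun y t =>
      ∃ b : Bool, y = encodeBool b ∧ (b = true ↔ G.Wins p Finset.univ) ∧
        t ≤ 20000 * (n + 1) ^ 5 * ((G.numColors + 1) ^ (τ ^ 2 / 4) * 3 ^ τ) := by
  have hM := isMatrix_encode G
  rw [encodeInstance]
  generalize encodeList _ = M at hM
  obtain ⟨C, hCτ, hC⟩ := G.graph.vertexCoverNum_exists
  lift C to Finset (Fin n) using C.toFinite
  rw [hτ, Set.encard_coe_eq_coe_finsetCard, Nat.cast_inj] at hCτ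
  have hτn : τ ≤ n := by
    rw [← hCτ]
    simpa using Finset.card_le_univ C
  apply computes_of_wp mainCode rfl
  simp only [wp, mainCode, Data.tl_cons, Data.hd_cons]
  refine (computes_pairs hM).mono ?_
  rintro y t1 ⟨ds, rfl, hds, h1⟩
  apply computes_of_wp mainEdgesCode rfl
  simp only [wp, mainEdgesCode, Code.snd, Code.tail2, Data.tl_cons, Data.hd_cons]
  refine (computes_find hds.entry (hds.covers_iff.2 hC) hCτ.le τ .nil (by simp)).mono ?_
  rintro s t2 ⟨⟨S, hs, hS, hSτ⟩, h2⟩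
  rw [hds.covers_iff] at hS
  -- The search starts from the empty memo `nil` and from the matrix as the full vertex set.
  refine (solves hM hs hS hds p Finset.univ (ColoredGraph.isBalanced_univ S) .nil M
    hM.represents_univ (fun k hk => by simp at hk)).mono ?_
  rintro y t3 ⟨m, rfl, -, -, h3⟩
  classical
  refine ⟨decide (G.Wins p Finset.univ), by simp [memoValue], by simp, ?_⟩
  set F := (G.numColors + 1) ^ (τ ^ 2 / 4) * 3 ^ τ
  -- The factor 2 accounts for the player to move, which is part of the key.
  have hload : load G S m ≤ 2 * F := by
    refine (load_le m).trans (card_allKeys_le.trans (Nat.mul_le_mul_left 2 ?_))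
    have hsq : S.card ^ 2 / 4 ≤ τ ^ 2 / 4 := Nat.div_le_div_right (Nat.pow_le_pow_left hSτ 2)
    exact Nat.mul_le_mul (Nat.pow_le_pow_right (Nat.succ_pos _) hsq)
      (Nat.pow_le_pow_right (by norm_num) hSτ)
  have hF : 2 ^ τ ≤ F := (Nat.pow_le_pow_left (by norm_num) τ).trans
    (Nat.le_mul_of_pos_left _ (by positivity))
  have hF1 : 1 ≤ F := Nat.one_le_two_pow.trans hF
  have hpow : ∀ k ≤ 5, (n + 1) ^ k ≤ (n + 1) ^ 5 * F := fun k hk =>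
    (Nat.pow_le_pow_right (Nat.succ_pos n) hk).trans (Nat.le_mul_of_pos_right _ hF1)
  have h4 : t2 ≤ 400 * ((n + 1) ^ 5 * F) := by
    refine h2.trans ?_
    have hlen : ds.length + 1 ≤ (n + 1) ^ 2 := by nlinarith [hds.length]
    calc (300 * (n + 1) * (ds.length + 1) * 2 ^ τ + 100) * (τ + 1)
        ≤ (300 * (n + 1) * (n + 1) ^ 2 * F + 100) * (n + 1) := by gcongr
      _ = 300 * ((n + 1) ^ 4 * F) + 100 * (n + 1) ^ 1 := by ring
      _ ≤ 300 * ((n + 1) ^ 5 * F) + 100 * ((n + 1) ^ 5 * F) := by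
        gcongr
        · omega
        · norm_num
        · exact hpow 1 (by norm_num)
      _ = _ := by ring
  have h5 : 3000 * (n + 1) ^ 5 * load G S m ≤ 6000 * ((n + 1) ^ 5 * F) := by
    calc _ ≤ 3000 * (n + 1) ^ 5 * (2 * F) := Nat.mul_le_mul_left _ hload
      _ = _ := by ring
  have h6 := hpow 3 (by norm_num)
  have h7 := hpow 0 (by norm_num)
  rw [pow_zero] at h7
  rw [mul_assoc]
  omega

theorem winnerDeterminedInTime_of_numColors_le {C : ∀ n : ℕ, ColoredGraph (Fin n) → Prop}
    {T : ℕ → ℝ} {γ : ℕ} (hγ : ∀ n G, C n G → G.numColors ≤ γ)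
    (hT : ∀ τ : ℕ, ((γ : ℝ) + 1) ^ ((τ : ℝ) ^ 2 / 4) * 3 ^ τ ≤ T τ) :
    WinnerDeterminedInTime C T := by
  refine ⟨prog, 30000 * (Polynomial.X + 1) ^ 5, fun n G p τ hG hτ => ?_⟩
  obtain ⟨body, y, t, hb, he, b, rfl, hbw, ht⟩ := computes_main G p hτ
  refine ⟨b, _, hbw, .call hb .arg he, ?_⟩
  set F := (G.numColors + 1) ^ (τ ^ 2 / 4) * 3 ^ τ with hFdef
  have hF1 : 1 ≤ F := Nat.one_le_iff_ne_zero.2 (by positivity)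
  have hF : (F : ℝ) ≤ T τ := by
    refine le_trans ?_ (hT τ)
    rw [hFdef, Nat.cast_mul]
    push_cast
    gcongr
    refine le_trans ?_ (pow_div_four_le_rpow γ τ)
    exact_mod_cast Nat.pow_le_pow_left (Nat.add_le_add_right (hγ n G hG) 1) _
  have h1 : 1 ≤ (n + 1) ^ 5 * F := Nat.one_le_iff_ne_zero.2 (by positivity)
  -- The two additional steps are those of the outermost call and its argument.
  have h2 : 1 + t + 1 ≤ 30000 * (n + 1) ^ 5 * F := by
    rw [mul_assoc] at ht ⊢
    omega
  calc ((1 + t + 1 : ℕ) : ℝ) ≤ ((30000 * (n + 1) ^ 5 * F : ℕ) : ℝ) := by exact_mod_cast h2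
    _ = ((30000 * (n + 1) ^ 5 : ℕ) : ℝ) * F := by rw [Nat.cast_mul]
    _ ≤ ((30000 * (n + 1) ^ 5 : ℕ) : ℝ) * T τ := by gcongr
    _ = _ := by simp

/-- The two hypotheses on b are compared factor by factor: b^(τ²) = (b^4)^(τ²/4) absorbs the lists
of types, and b^(eτ) absorbs 3^τ. -/
theorem rpow_quarter_mul_pow_le {c b e : ℝ} (hc : 0 ≤ c) (hb : 0 < b) (hcb : c ≤ b ^ 4)
    (h3 : 3 ≤ b ^ e) (τ : ℕ) :
    c ^ ((τ : ℝ) ^ 2 / 4) * 3 ^ τ ≤ b ^ ((τ : ℝ) ^ 2 + e * τ) := by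
  rw [Real.rpow_add hb, Real.rpow_mul hb.le, Real.rpow_natCast]
  have h : b ^ ((τ : ℝ) ^ 2) = (b ^ 4) ^ ((τ : ℝ) ^ 2 / 4) := by
    rw [← Real.rpow_natCast b 4, ← Real.rpow_mul hb.le]
    congr 1
    push_cast
    ring
  rw [h]
  gcongr

/-- Turns the condition on a rational exponent into an inequality between natural powers, which can
be evaluated exactly. -/
theorem three_le_rpow_div {b : ℝ} (hb : 0 ≤ b) {k m : ℕ} (hm : m ≠ 0) (h : 3 ^ m ≤ b ^ k) :
    3 ≤ b ^ ((k : ℝ) / m) := by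
  have hb' : b ^ k = (b ^ ((k : ℝ) / m)) ^ m := by
    rw [← Real.rpow_natCast (b ^ _), ← Real.rpow_mul hb, div_mul_cancel₀ _ (by exact_mod_cast hm),
      Real.rpow_natCast]
  rw [hb'] at h
  exact le_of_pow_le_pow_left₀ hm (by positivity) h

theorem ColoredGraph.numColors_le_of_subset {V : Type*} (G : ColoredGraph V)
    (s : Finset EdgeColor) (h : ∀ u v c, G.color u v = some c → c ∈ s) :
    G.numColors ≤ s.card := by
  rw [numColors, ← Set.ncard_coe_finset]
  refine Set.ncard_le_ncard ?_ s.finite_toSet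
  rintro c ⟨u, v, hc⟩
  exact h u v c hc

end ArcKayles

/-! ### The main theorem -/

set_option exponentiation.threshold 400 in
theorem mainTheorem1 :
    -- running times for Colored Arc Kayles, BW-Arc Kayles and Arc Kayles
    ArcKayles.WinnerDeterminedInTime (fun _ _ => True)
        (fun τ => (1.4143 : ℝ) ^ ((τ : ℝ) ^ 2 + 3.17 * (τ : ℝ))) ∧
      ArcKayles.WinnerDeterminedInTime (fun _ G => G.IsBW)
        (fun τ => (1.3161 : ℝ) ^ ((τ : ℝ) ^ 2 + 4 * (τ : ℝ))) ∧
      ArcKayles.WinnerDeterminedInTime (fun _ G => G.IsArcKayles)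
        (fun τ => (1.1893 : ℝ) ^ ((τ : ℝ) ^ 2 + 6.34 * (τ : ℝ))) ∧
      -- the recursion over edges inside `S` and edges from `S` to representatives
      (∀ (V : Type*) [Fintype V] [DecidableEq V] (G : ArcKayles.ColoredGraph V) (S : Finset V),
        G.graph.IsVertexCover (S : Set V) →
          ∀ (p : ArcKayles.Player) (A R : Finset V), G.IsRepresentativeSystem S A R →
            (G.Wins p A ↔ ∃ u v, u ∈ S ∧ (v ∈ S ∨ v ∈ R) ∧ G.IsMove p A u v ∧
              ¬ G.Wins p.other (A \ {u, v}))) ∧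
      -- the number of distinct positions
      (∀ (V : Type*) [Fintype V] [DecidableEq V] (G : ArcKayles.ColoredGraph V) (S : Finset V),
        G.graph.IsVertexCover (S : Set V) → S.Nonempty →
          (G.numPositions S : ℝ) ≤
            ((G.numColors : ℝ) + 1) ^ ((S.card : ℝ) ^ 2 / 4) * 3 ^ S.card * (S.card : ℝ) ^ 2) := by
  refine ⟨?_, ?_, ?_, fun V _ _ G S hS p A R hR => G.wins_iff_representatives hS hR p,
    fun V _ _ G S hS hne => G.numPositions_le_rpow hS hne⟩
  · refine ArcKayles.winnerDeterminedInTime_of_numColors_le (γ := 3)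
      (fun n G _ => (G.numColors_le_of_subset {.gray, .black, .white} fun u v c _ => by
        cases c <;> simp).trans_eq rfl) fun τ =>
        ArcKayles.rpow_quarter_mul_pow_le (by norm_num) (by norm_num) (by norm_num) ?_ τ
    -- With γ = 3 the numerical facts are 4 ≤ 1.4143^4 and 3^100 ≤ 1.4143^317.
    rw [show (3.17 : ℝ) = (((317 : ℕ) : ℝ) / ((100 : ℕ) : ℝ)) by norm_num]
    exact ArcKayles.three_le_rpow_div (by norm_num) (by norm_num) (by norm_num)
  · refine ArcKayles.winnerDeterminedInTime_of_numColors_le (γ := 2)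
      (fun n G hG => (G.numColors_le_of_subset {.black, .white} fun u v c hc => by
        cases c
        · exact absurd hc (hG u v)
        all_goals simp).trans_eq rfl) fun τ =>
        ArcKayles.rpow_quarter_mul_pow_le (by norm_num) (by norm_num) (by norm_num) ?_ τ
    -- With γ = 2 both conditions become 3 ≤ 1.3161^4.
    rw [show (4 : ℝ) = (((4 : ℕ) : ℝ) / ((1 : ℕ) : ℝ)) by norm_num]
    exact ArcKayles.three_le_rpow_div (by norm_num) (by norm_num) (by norm_num)
  · refine ArcKayles.winnerDeterminedInTime_of_numColors_le (γ := 1)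
      (fun n G hG => G.numColors_le_of_subset {.gray} fun u v c hc => by
        simpa using hG u v c hc) fun τ =>
        ArcKayles.rpow_quarter_mul_pow_le (by norm_num) (by norm_num) (by norm_num) ?_ τ
    -- With γ = 1 the numerical facts are 2 ≤ 1.1893^4 and 3^50 ≤ 1.1893^317.
    rw [show (6.34 : ℝ) = (((317 : ℕ) : ℝ) / ((50 : ℕ) : ℝ)) by norm_num]
    exact ArcKayles.three_le_rpow_div (by norm_num) (by norm_num) (by norm_num)
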